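/- A link is a tame link in $3$-space, i.e. up to equivalence a non-empty finite disjoint union of simple closed polygons; a diagram of a link $L$ is a regular projection, with over/under information, of a link equivalent to $L$. The link $L$ is split if it is equivalent to a link that is contained in the union of two disjoint balls and meets both of them, and non-split otherwise. For an integer $p>1$, a $p$-coloring of a diagram assigns an element of $\mathbb{Z}/p$ (a color) to each arc such that at each crossing twice the color of the over-arc equals the sum of the colors of the two under-arcs. It is non-trivial if it uses at least two distinct colors. If $L$ admits non-trivial $p$-colorings, let $\mathrm{mincol}_p L$ and $\mathrm{maxcol}_p L$ be the minimum and the maximum number of distinct colors used by a non-trivial $p$-coloring of a diagram of $L$, over all diagrams of $L$ and all their non-trivial $p$-colorings. Let $p>1$ be an integer, prime or composite, and let $L$ be a non-split link that admits non-trivial $p$-colorings. 1. If some diagram of $L$ has a non-trivial $p$-coloring that uses exactly $\mathrm{mincol}_p L$ colors and has a crossing at which the over-arc has color $1$ and the two under-arcs have colors $0$ and $2$ (mod $p$), then $\mathrm{maxcol}_p L = p$. 2. If some diagram of $L$ has a non-trivial $p$-coloring that uses exactly $\mathrm{mincol}_p L$ colors and has a crossing at which the over-arc has color $b$ and the two under-arcs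 have colors $a$ and $2b-a$, where $b-a$ is invertible mod $p$, then $\mathrm{maxcol}_p L = p$. -/

import Mathlib

namespace FoxColoring

/-- Euclidean 3-space. -/
abbrev E3 : Type := EuclideanSpace ℝ (Fin 3)

/-- The half-open straight edge from `a` (included) to `b` (excluded). -/
def halfOpenEdge (a b : E3) : Set E3 :=
  (fun t : ℝ => AffineMap.lineMap a b t) '' Set.Ico 0 1

/-- `K` is a nonempty finite disjoint union of simple closed polygons in 3-space. The finitely many
vertices are `pos v`, the permutation `next` runs cyclically through the vertices of each polygon;
edges are non-degenerate, and, as the half-open edges are pairwise disjoint, two different closed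
edges meet at most in a common end point. -/
def IsPolygonalLink (K : Set E3) : Prop :=
  ∃ (V : Type) (_ : Fintype V) (_ : Nonempty V) (next : Equiv.Perm V) (pos : V → E3),
    (∀ v, next v ≠ v) ∧
    (∀ v w, v ≠ w →
      Disjoint (halfOpenEdge (pos v) (pos (next v))) (halfOpenEdge (pos w) (pos (next w)))) ∧
    K = ⋃ v, halfOpenEdge (pos v) (pos (next v))

/-- A (tame, unoriented) link, represented by a polygonal link in 3-space. -/
structure Link where
  /-- the underlying point set -/
  carrier : Set E3
  isPolygonalLink : IsPolygonalLink carrier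

/-- An elementary move: for a non-degenerate triangle `ABC` that meets `K` exactly in the side
`AB`, the side `AB` is replaced by the two other sides. -/
def TriangleMove (K K' : Link) : Prop :=
  ∃ A B C : E3, AffineIndependent ℝ ![A, B, C] ∧
    K.carrier ∩ convexHull ℝ {A, B, C} = segment ℝ A B ∧
    K'.carrier = (K.carrier \ segment ℝ A B) ∪ (segment ℝ A C ∪ segment ℝ C B)

/-- Two links are equivalent (the same link type) if a finite sequence of elementary moves and
their inverses leads from one to the other. -/
def Link.Equivalent : Link → Link → Prop := Relation.EqvGen TriangleMove

/-- `L` is split: it can be moved into two disjoint balls, with a part of it in each. -/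
def Link.IsSplit (L : Link) : Prop :=
  ∃ K : Link, K.Equivalent L ∧ ∃ (x y : E3) (r s : ℝ),
    Disjoint (Metric.closedBall x r) (Metric.closedBall y s) ∧
    K.carrier ⊆ Metric.closedBall x r ∪ Metric.closedBall y s ∧
    (K.carrier ∩ Metric.closedBall x r).Nonempty ∧
    (K.carrier ∩ Metric.closedBall y s).Nonempty

/-- The projection of 3-space to the plane along the third coordinate. -/
def proj (x : E3) : ℝ × ℝ := (x 0, x 1)

/-- Near its point `x`, the set `K` is a straight open segment through `x` in direction `v`. -/
def IsStraightAt (K : Set E3) (x v : E3) : Prop :=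
  v ≠ 0 ∧ ∃ ε > 0, ∀ y ∈ Metric.ball x ε, (y ∈ K ↔ ∃ t : ℝ, y = x + t • v)

/-- A link diagram: a polygonal link in general position with respect to the projection to the
plane. The only multiple points of the projection are double points, and at a double point two
straight strands cross transversally. The third coordinate tells which of them is the upper one. -/
structure Diagram extends Link where
  double : ∀ x ∈ carrier, ∀ y ∈ carrier, ∀ z ∈ carrier,
    proj x = proj y → proj y = proj z → x = y ∨ y = z ∨ x = z
  transversal : ∀ x ∈ carrier, ∀ y ∈ carrier, x ≠ y → proj x = proj y →
    ∃ u v : E3, IsStraightAt carrier x u ∧ IsStraightAt carrier y v ∧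
      LinearIndependent ℝ ![proj u, proj v]

namespace Diagram

/-- `D` is a diagram of the link `L`. -/
def IsDiagramOf (D : Diagram) (L : Link) : Prop := D.toLink.Equivalent L

/-- At a crossing of `D`, the point `o` of the upper strand lies above the point `u` of the lower
strand. -/
def IsOver (D : Diagram) (o u : E3) : Prop :=
  o ∈ D.carrier ∧ u ∈ D.carrier ∧ proj o = proj u ∧ u 2 < o 2

/-- The link of the diagram, cut at all of its under-crossing points. -/
def cut (D : Diagram) : Set E3 := {x | x ∈ D.carrier ∧ ¬ ∃ o, D.IsOver o x}

/-- The arcs of the diagram. -/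
abbrev Arc (D : Diagram) : Type := ConnectedComponents D.cut

/-- The point `x` lies on the arc `α`. -/
def OnArc (D : Diagram) (x : E3) (α : D.Arc) : Prop :=
  ∃ h : x ∈ D.cut, ConnectedComponents.mk (⟨x, h⟩ : D.cut) = α

/-- There is a crossing of `D` with over-arc `β`, at which the two under-arcs, on the two sides of
the over-arc, are `α` and `γ`. -/
def IsCrossing (D : Diagram) (α β γ : D.Arc) : Prop :=
  ∃ o u v : E3, D.IsOver o u ∧ IsStraightAt D.carrier u v ∧ D.OnArc o β ∧
    ∃ ε > 0, ∀ t ∈ Set.Ioo (0 : ℝ) ε, D.OnArc (u - t • v) α ∧ D.OnArc (u + t • v) γ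

end Diagram

/-- A `p`-coloring of a diagram: at each crossing, twice the color of the over-arc is the sum of
the colors of the under-arcs. -/
structure Coloring (p : ℕ) (D : Diagram) where
  color : D.Arc → ZMod p
  rule : ∀ α β γ : D.Arc, D.IsCrossing α β γ → 2 * color β = color α + color γ

namespace Coloring

variable {p : ℕ} {D : Diagram}

/-- A coloring is non-trivial if it uses more than one color. -/
def IsNontrivial (c : Coloring p D) : Prop := ∃ α β : D.Arc, c.color α ≠ c.color β

/-- The number of distinct colors that a coloring uses. -/
noncomputable def numColors (c : Coloring p D) : ℕ := (Set.range c.color).ncard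

end Coloring

/-- The maximum number of colors in a non-trivial `p`-coloring of the diagram `D`. For `p > 0` the
set has the upper bound `p`, so that the supremum is a maximum as soon as `D` has a non-trivial
`p`-coloring. -/
noncomputable def maxColorsOn (p : ℕ) (D : Diagram) : ℕ :=
  sSup {n | ∃ c : Coloring p D, c.IsNontrivial ∧ c.numColors = n}

/-- The link `L` admits non-trivial `p`-colorings. -/
def AdmitsNontrivialColoring (p : ℕ) (L : Link) : Prop :=
  ∃ D : Diagram, D.IsDiagramOf L ∧ ∃ c : Coloring p D, c.IsNontrivial

/-- The maximum number of colors of `L` mod `p`: the maximum, over all diagrams of `L`, of the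
maximum number of colors in a non-trivial `p`-coloring of the diagram. For `p > 0` the set has the
upper bound `p`. -/
noncomputable def maxcol (p : ℕ) (L : Link) : ℕ :=
  sSup {n | ∃ D : Diagram, D.IsDiagramOf L ∧ maxColorsOn p D = n}

/-- The minimum number of colors of `L` mod `p`: the least number of colors in a non-trivial
`p`-coloring of a diagram of `L`. -/
noncomputable def mincol (p : ℕ) (L : Link) : ℕ :=
  sInf {n | ∃ D : Diagram, D.IsDiagramOf L ∧
    ∃ c : Coloring p D, c.IsNontrivial ∧ c.numColors = n}

end FoxColoring

namespace FoxColoring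

open Set Filter Topology

/-! Take a crossing with over-arc of color `a + d` and under-arcs of colors `a` and `a + 2d`. Push a
piece of the upper strand beneath the under-arc of color `a + 2d` (a Reidemeister II move). The link
type is unchanged, all old colors survive, and the tip of the pushed strand becomes a new arc, which
must have color `2(a + 2d) - (a + d) = a + 3d`. One of the two new crossings has under-arcs `a + d`,
`a + 3d` and over-arc `a + 2d`: the same picture shifted by `d`. Iterating produces every `a + kd`.
If `d` is a unit mod `p`, these are all the elements of `ZMod p`, and no coloring uses more than `p`
colors.

The work lies in carrying out the push on actual polygons. `Diagram.exists_crossingChart` gives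
linear coordinates in which the link over a square is two straight lines. In them the push is one
explicit `TriangleMove` (`Diagram.triangleMove_push`), and `Diagram.push` checks general position.
Arcs are connected components, so colors are transported topologically: a continuous map `collapse`
sends new arcs to old ones, and the tip is separated off as a clopen set. `pushColoring` verifies
the coloring rule, `Coloring.exists_push` is one push, and `Coloring.exists_progression` is the
iteration. -/

/-! ### Edges of polygonal links: subdivision and detours -/

/-- `K` is a polygonal link, one of whose edges leads from `A` to `B`. -/
def HasEdge (K : Set E3) (A B : E3) : Prop :=
  ∃ (V : Type) (_ : Fintype V) (_ : Nonempty V) (next : Equiv.Perm V) (pos : V → E3),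
    (∀ v, next v ≠ v) ∧
    (∀ v w, v ≠ w →
      Disjoint (halfOpenEdge (pos v) (pos (next v))) (halfOpenEdge (pos w) (pos (next w)))) ∧
    K = (⋃ v, halfOpenEdge (pos v) (pos (next v))) ∧
    ∃ v, pos v = A ∧ pos (next v) = B

theorem HasEdge.isPolygonalLink {K : Set E3} {A B : E3} (h : HasEdge K A B) :
    IsPolygonalLink K := by
  obtain ⟨V, i, j, next, pos, h1, h2, h3, -⟩ := h
  exact ⟨V, i, j, next, pos, h1, h2, h3⟩

theorem mem_halfOpenEdge {a b x : E3} :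
    x ∈ halfOpenEdge a b ↔ ∃ t : ℝ, 0 ≤ t ∧ t < 1 ∧ AffineMap.lineMap a b t = x := by
  simp [halfOpenEdge, and_assoc]

theorem left_mem_halfOpenEdge (a b : E3) : a ∈ halfOpenEdge a b :=
  mem_halfOpenEdge.2 ⟨0, le_rfl, one_pos, by simp⟩

theorem halfOpenEdge_union_right (a b : E3) : halfOpenEdge a b ∪ {b} = segment ℝ a b := by
  rw [segment_eq_image_lineMap, ← Ico_union_right (zero_le_one' ℝ), image_union, image_singleton,
    AffineMap.lineMap_apply_one]
  rfl

theorem halfOpenEdge_subset_segment (a b : E3) : halfOpenEdge a b ⊆ segment ℝ a b := by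
  rw [← halfOpenEdge_union_right]; exact subset_union_left

theorem convex_halfOpenEdge (a b : E3) : Convex ℝ (halfOpenEdge a b) :=
  (convex_Ico (0 : ℝ) 1).affine_image (AffineMap.lineMap a b : ℝ →ᵃ[ℝ] E3)

/-- The end point missing from each half-open edge is the first point of the next edge, so closing
all the edges does not change their union. -/
theorem IsPolygonalLink.isCompact {K : Set E3} (h : IsPolygonalLink K) : IsCompact K := by
  obtain ⟨V, _, _, next, pos, h1, h2, rfl⟩ := h
  have : (⋃ v, halfOpenEdge (pos v) (pos (next v))) = ⋃ v, segment ℝ (pos v) (pos (next v)) := by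
    apply subset_antisymm
    · exact iUnion_mono fun v => halfOpenEdge_subset_segment _ _
    · refine iUnion_subset fun v => ?_
      rw [← halfOpenEdge_union_right]
      refine union_subset (subset_iUnion_of_subset v subset_rfl) ?_
      rintro _ rfl
      exact mem_iUnion.2 ⟨next v, left_mem_halfOpenEdge _ _⟩
  rw [this]
  refine isCompact_iUnion fun v => ?_
  rw [segment_eq_image_lineMap]
  exact isCompact_Icc.image AffineMap.lineMap_continuous

/-- The new vertex `X` need not lie on the edge: a point of the edge gives a subdivision of the same
set, a point off it gives a detour. -/
theorem HasEdge.insert {K : Set E3} {A B X : E3} (h : HasEdge K A B)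
    (hd : Disjoint (halfOpenEdge A X) (halfOpenEdge X B))
    (hA : Disjoint (halfOpenEdge A X) (K \ halfOpenEdge A B))
    (hB : Disjoint (halfOpenEdge X B) (K \ halfOpenEdge A B)) :
    HasEdge ((K \ halfOpenEdge A B) ∪ (halfOpenEdge A X ∪ halfOpenEdge X B)) A X ∧
    HasEdge ((K \ halfOpenEdge A B) ∪ (halfOpenEdge A X ∪ halfOpenEdge X B)) X B := by
  classical
  obtain ⟨V, _, _, next, pos, h1, h2, hK, v, rfl, rfl⟩ := h
  -- The vertex `none` is spliced into the cycle of `v`: `some v ↦ none ↦ some (next v)`.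
  let next' : Equiv.Perm (Option V) := Equiv.optionCongr next * Equiv.swap none (some v)
  let pos' : Option V → E3 := fun w => w.elim X pos
  have n0 : next' none = some (next v) := by simp [next']
  have n1 : next' (some v) = none := by simp [next']
  have n2 : ∀ w, w ≠ v → next' (some w) = some (next w) := by
    intro w hw
    simp [next', Equiv.swap_apply_of_ne_of_ne, hw]
  have hsub : ∀ w, w ≠ v → halfOpenEdge (pos w) (pos (next w)) ⊆
      K \ halfOpenEdge (pos v) (pos (next v)) := by
    intro w hw x hx
    refine ⟨hK ▸ mem_iUnion.2 ⟨w, hx⟩, fun hx' => ?_⟩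
    exact (h2 w v hw).le_bot ⟨hx, hx'⟩
  have hne : ∀ w, next' w ≠ w := by
    rintro (_ | w)
    · simp [n0]
    · by_cases hw : w = v
      · subst hw; simp [n1]
      · rw [n2 w hw]; simpa using h1 w
  have e0 : halfOpenEdge (pos' none) (pos' (next' none)) = halfOpenEdge X (pos (next v)) := by
    rw [n0]; rfl
  have e1 : halfOpenEdge (pos' (some v)) (pos' (next' (some v))) = halfOpenEdge (pos v) X := by
    rw [n1]; rfl
  have e2 : ∀ w, w ≠ v → halfOpenEdge (pos' (some w)) (pos' (next' (some w))) =
      halfOpenEdge (pos w) (pos (next w)) := by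
    intro w hw; rw [n2 w hw]; rfl
  have hdis : ∀ a b, a ≠ b → Disjoint (halfOpenEdge (pos' a) (pos' (next' a)))
      (halfOpenEdge (pos' b) (pos' (next' b))) := by
    rintro (_ | a) (_ | b) hab
    · exact absurd rfl hab
    · rw [e0]
      by_cases hb : b = v
      · subst hb; rw [e1]; exact hd.symm
      · rw [e2 b hb]; exact hB.mono_right (hsub b hb)
    · rw [e0]
      by_cases ha : a = v
      · subst ha; rw [e1]; exact hd
      · rw [e2 a ha]; exact (hB.mono_right (hsub a ha)).symm
    · by_cases ha : a = v
      · subst ha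
        have hb : b ≠ a := fun h => hab (by rw [h])
        rw [e1, e2 b hb]; exact hA.mono_right (hsub b hb)
      · rw [e2 a ha]
        by_cases hb : b = v
        · subst hb; rw [e1]; exact (hA.mono_right (hsub a ha)).symm
        · rw [e2 b hb]; exact h2 a b fun h => hab (by rw [h])
  have hU : (K \ halfOpenEdge (pos v) (pos (next v))) ∪
      (halfOpenEdge (pos v) X ∪ halfOpenEdge X (pos (next v))) =
      ⋃ w, halfOpenEdge (pos' w) (pos' (next' w)) := by
    apply subset_antisymm
    · rintro x (⟨hx, hx'⟩ | hx | hx)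
      · rw [hK] at hx
        obtain ⟨w, hw⟩ := mem_iUnion.1 hx
        have hwv : w ≠ v := by rintro rfl; exact hx' hw
        exact mem_iUnion.2 ⟨some w, by rwa [e2 w hwv]⟩
      · exact mem_iUnion.2 ⟨some v, by rwa [e1]⟩
      · exact mem_iUnion.2 ⟨none, by rwa [e0]⟩
    · refine iUnion_subset ?_
      rintro (_ | w)
      · rw [e0]; exact fun x hx => Or.inr (Or.inr hx)
      · by_cases hw : w = v
        · subst hw; rw [e1]; exact fun x hx => Or.inr (Or.inl hx)
        · rw [e2 w hw]; exact fun x hx => Or.inl (hsub w hw hx)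
  exact ⟨⟨Option V, inferInstance, inferInstance, next', pos', hne, hdis, hU, some v, rfl,
    by rw [n1]; rfl⟩, ⟨Option V, inferInstance, inferInstance, next', pos', hne, hdis, hU, none, rfl,
    by rw [n0]; rfl⟩⟩

theorem HasEdge.subdivide {K : Set E3} {A B : E3} (h : HasEdge K A B) (hAB : A ≠ B) {t : ℝ}
    (h0 : 0 < t) (h1 : t < 1) :
    HasEdge K A (AffineMap.lineMap A B t) ∧ HasEdge K (AffineMap.lineMap A B t) B := by
  have eA : halfOpenEdge A (AffineMap.lineMap A B t) = AffineMap.lineMap A B '' Ico (0 : ℝ) t := by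
    ext x
    rw [mem_halfOpenEdge]
    constructor
    · rintro ⟨s, hs0, hs1, rfl⟩
      refine ⟨s * t, ⟨by positivity, by nlinarith⟩, ?_⟩
      simp only [AffineMap.lineMap_apply_module]
      module
    · rintro ⟨s, ⟨hs0, hs1⟩, rfl⟩
      refine ⟨s / t, by positivity, (div_lt_one h0).2 hs1, ?_⟩
      obtain ⟨r, rfl⟩ : ∃ r, s = r * t := ⟨s / t, by field_simp⟩
      rw [mul_div_cancel_right₀ _ h0.ne']
      simp only [AffineMap.lineMap_apply_module]
      module
  have eB : halfOpenEdge (AffineMap.lineMap A B t) B = AffineMap.lineMap A B '' Ico t (1 : ℝ) := by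
    have h1' : 0 < 1 - t := by linarith
    ext x
    rw [mem_halfOpenEdge]
    constructor
    · rintro ⟨s, hs0, hs1, rfl⟩
      refine ⟨t + s * (1 - t), ⟨by nlinarith, by nlinarith⟩, ?_⟩
      simp only [AffineMap.lineMap_apply_module]
      module
    · rintro ⟨s, ⟨hs0, hs1⟩, rfl⟩
      refine ⟨(s - t) / (1 - t), div_nonneg (by linarith) h1'.le,
        (div_lt_one h1').2 (by linarith), ?_⟩
      obtain ⟨r, rfl⟩ : ∃ r, s = t + r * (1 - t) := ⟨(s - t) / (1 - t), by field_simp; ring⟩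
      rw [add_sub_cancel_left, mul_div_cancel_right₀ _ h1'.ne']
      simp only [AffineMap.lineMap_apply_module]
      module
  have hunion : halfOpenEdge A (AffineMap.lineMap A B t) ∪ halfOpenEdge (AffineMap.lineMap A B t) B
      = halfOpenEdge A B := by
    rw [eA, eB, ← image_union, Ico_union_Ico_eq_Ico h0.le h1.le]
    rfl
  have hsub : halfOpenEdge A B ⊆ K := by
    obtain ⟨V, _, _, next, pos, -, -, hK, v, rfl, rfl⟩ := h
    rw [hK]; exact subset_iUnion (fun v => halfOpenEdge (pos v) (pos (next v))) v
  have hdis : ∀ s ⊆ halfOpenEdge A B, Disjoint s (K \ halfOpenEdge A B) := fun s hs =>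
    disjoint_sdiff_self_right.mono_left hs
  have key := h.insert (X := AffineMap.lineMap A B t) ?_ (hdis _ (hunion ▸ subset_union_left))
    (hdis _ (hunion ▸ subset_union_right))
  · rwa [hunion, sdiff_union_of_subset hsub] at key
  · rw [eA, eB]
    refine (disjoint_image_iff (AffineMap.lineMap_injective ℝ hAB)).2 ?_
    rw [Set.disjoint_left]
    rintro s ⟨_, h⟩ ⟨h', _⟩
    exact absurd h h'.not_gt

theorem HasEdge.subsegment_aux {K : Set E3} {A B : E3} (h : HasEdge K A B) (hAB : A ≠ B) {s t : ℝ}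
    (hs : 0 ≤ s) (hst : s < t) (ht : t < 1) :
    HasEdge K (AffineMap.lineMap A B s) (AffineMap.lineMap A B t) := by
  have h0 : 0 < t := hs.trans_lt hst
  have hQ := (h.subdivide hAB h0 ht).1
  rcases hs.eq_or_lt with rfl | hs
  · simpa using hQ
  have hne : A ≠ AffineMap.lineMap A B t := by
    intro h
    have := AffineMap.lineMap_injective ℝ hAB
      (show AffineMap.lineMap A B (0 : ℝ) = AffineMap.lineMap A B t by simpa using h)
    exact h0.ne this
  have := (hQ.subdivide hne (div_pos hs h0) ((div_lt_one h0).2 hst)).2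
  convert this using 1
  obtain ⟨r, rfl⟩ : ∃ r, s = r * t := ⟨s / t, by field_simp⟩
  rw [mul_div_cancel_right₀ _ h0.ne']
  simp only [AffineMap.lineMap_apply_module]
  module

theorem HasEdge.subsegment {K : Set E3} {A B P Q : E3} (h : HasEdge K A B)
    (hP : P ∈ halfOpenEdge A B) (hQ : Q ∈ halfOpenEdge A B) (hPQ : P ≠ Q) :
    HasEdge K P Q ∨ HasEdge K Q P := by
  obtain ⟨s, hs0, hs1, rfl⟩ := mem_halfOpenEdge.1 hP
  obtain ⟨t, ht0, ht1, rfl⟩ := mem_halfOpenEdge.1 hQ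
  have hAB : A ≠ B := by rintro rfl; simp at hPQ
  rcases lt_trichotomy s t with hst | rfl | hst
  · exact Or.inl (h.subsegment_aux hAB hs0 hst ht1)
  · exact absurd rfl hPQ
  · exact Or.inr (h.subsegment_aux hAB ht0 hst hs1)

theorem right_notMem_halfOpenEdge {a b : E3} (h : a ≠ b) : b ∉ halfOpenEdge a b := by
  intro hb
  obtain ⟨t, ht0, ht1, ht⟩ := mem_halfOpenEdge.1 hb
  exact ht1.ne (AffineMap.lineMap_injective ℝ h (by simpa using ht))

/-- Replacing an edge `PQ` by a detour `PRQ` that misses the rest of the link. -/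
theorem HasEdge.detour {K : Set E3} {P Q R : E3} (h : HasEdge K P Q) (hPQ : P ≠ Q)
    (hd : Disjoint (halfOpenEdge P R) (halfOpenEdge R Q))
    (hP : Disjoint (halfOpenEdge P R) (K \ halfOpenEdge P Q))
    (hQ : Disjoint (halfOpenEdge R Q) (K \ halfOpenEdge P Q)) :
    IsPolygonalLink ((K \ segment ℝ P Q) ∪ (segment ℝ P R ∪ segment ℝ R Q)) := by
  have hQK : Q ∈ K := by
    obtain ⟨V, _, _, next, pos, -, -, hK, v, rfl, rfl⟩ := h
    rw [hK]; exact mem_iUnion.2 ⟨next v, left_mem_halfOpenEdge _ _⟩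
  -- Deleting the closed segment also deletes `Q`, but `Q` comes back as the end of `RQ`; likewise
  -- the end `R` of `PR` is the start of `RQ`.
  convert (h.insert hd hP hQ).1.isPolygonalLink using 1
  have hQe : Q ∉ halfOpenEdge P Q := right_notMem_halfOpenEdge hPQ
  rw [← halfOpenEdge_union_right P Q, ← halfOpenEdge_union_right P R, ← halfOpenEdge_union_right R Q]
  have hR : R ∈ halfOpenEdge R Q := left_mem_halfOpenEdge _ _
  ext x
  simp only [mem_union, Set.mem_sdiff, mem_singleton_iff]
  by_cases hx : x = Q
  · subst hx; simp [hQK, hQe]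
  · by_cases hxR : x = R
    · subst hxR; simp [hR]
    · simp [hx, hxR]

theorem HasEdge.detour_of_inter {K : Set E3} {P Q R : E3} (h : HasEdge K P Q) (hPQ : P ≠ Q)
    (hPR : P ≠ R) (hRQ : R ≠ Q) (hR : ∀ x ∈ segment ℝ P R, x ∈ segment ℝ R Q → x = R)
    (hK : ∀ x ∈ segment ℝ P R ∪ segment ℝ R Q, x ∈ K → x = P ∨ x = Q) :
    IsPolygonalLink ((K \ segment ℝ P Q) ∪ (segment ℝ P R ∪ segment ℝ R Q)) := by
  refine h.detour hPQ ?_ ?_ ?_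
  · rw [Set.disjoint_left]
    intro x hx hx'
    have := hR x (halfOpenEdge_subset_segment _ _ hx) (halfOpenEdge_subset_segment _ _ hx')
    subst this
    exact right_notMem_halfOpenEdge hPR hx
  · rw [Set.disjoint_left]
    rintro x hx ⟨hxK, hx'⟩
    have hx := halfOpenEdge_subset_segment _ _ hx
    rcases hK x (Or.inl hx) hxK with rfl | rfl
    · exact hx' (left_mem_halfOpenEdge _ _)
    · exact hRQ (hR _ hx (right_mem_segment ℝ _ _)).symm
  · rw [Set.disjoint_left]
    rintro x hx ⟨hxK, hx'⟩
    rcases hK x (Or.inr (halfOpenEdge_subset_segment _ _ hx)) hxK with rfl | rfl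
    · exact hx' (left_mem_halfOpenEdge _ _)
    · exact right_notMem_halfOpenEdge hRQ hx

/-- A straight strand may pass through vertices, whereas a detour replaces part of a single edge. As
there are finitely many edges, one of them contains points of the ray arbitrarily close to `o`, and
by convexity a whole initial piece of it. -/
theorem IsPolygonalLink.exists_hasEdge_ray {K : Set E3} (hK : IsPolygonalLink K) {o w : E3} {ε : ℝ}
    (hε : 0 < ε) (hw : ∀ t : ℝ, 0 < t → t < ε → o + t • w ∈ K) :
    ∃ A B, HasEdge K A B ∧ ∃ s > 0, ∀ t : ℝ, 0 < t → t ≤ s → o + t • w ∈ halfOpenEdge A B := by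
  obtain ⟨V, _, _, next, pos, h1, h2, rfl⟩ := id hK
  have hf : ∃ᶠ t in 𝓝[>] (0 : ℝ), ∃ v, o + t • w ∈ halfOpenEdge (pos v) (pos (next v)) := by
    refine Eventually.frequently ?_
    filter_upwards [Ioo_mem_nhdsGT hε] with t ht
    exact mem_iUnion.1 (hw t ht.1 ht.2)
  obtain ⟨v, hv⟩ := frequently_exists.1 hf
  obtain ⟨s, hs, hs0⟩ := (hv.and_eventually self_mem_nhdsWithin).exists
  refine ⟨_, _, ⟨V, ‹_›, ‹_›, next, pos, h1, h2, rfl, v, rfl, rfl⟩, s, hs0, fun t ht hts => ?_⟩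
  obtain ⟨r, hr, hr0⟩ := (hv.and_eventually (Ioo_mem_nhdsGT ht)).exists
  refine (convex_halfOpenEdge _ _).segment_subset hr hs ?_
  have hrs : 0 < s - r := by linarith [hr0.2]
  refine ⟨(s - t) / (s - r), (t - r) / (s - r), div_nonneg (by linarith) hrs.le,
    div_nonneg (by linarith [hr0.2]) hrs.le, by field_simp; ring, ?_⟩
  have e1 : (s - t) / (s - r) = 1 - (t - r) / (s - r) := by field_simp; ring
  obtain ⟨q, hq⟩ : ∃ q, q = (t - r) / (s - r) := ⟨_, rfl⟩
  have e2 : t = r + q * (s - r) := by rw [hq]; field_simp; ring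
  rw [e1, ← hq, e2]
  module

/-! ### Projection and straight strands -/

/-- The projection to the plane as a continuous linear map. -/
noncomputable def projL : E3 →L[ℝ] ℝ × ℝ :=
  (EuclideanSpace.proj (0 : Fin 3) : E3 →L[ℝ] ℝ).prod (EuclideanSpace.proj (1 : Fin 3) : E3 →L[ℝ] ℝ)

theorem proj_add (x y : E3) : proj (x + y) = proj x + proj y := projL.map_add x y

theorem proj_sub (x y : E3) : proj (x - y) = proj x - proj y := projL.map_sub x y

theorem proj_smul (c : ℝ) (x : E3) : proj (c • x) = c • proj x := projL.map_smul c x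

theorem tendsto_ray (x v : E3) : Tendsto (fun t : ℝ => x + t • v) (𝓝 0) (𝓝 x) := by
  have : Continuous fun t : ℝ => x + t • v := by fun_prop
  simpa using this.tendsto 0

theorem IsStraightAt.eventually_mem {K : Set E3} {x v : E3} (h : IsStraightAt K x v) :
    ∀ᶠ t : ℝ in 𝓝 0, x + t • v ∈ K := by
  obtain ⟨-, ε, hε, h⟩ := h
  filter_upwards [(tendsto_ray x v).eventually (Metric.ball_mem_nhds x hε)] with t ht
  exact (h _ ht).2 ⟨t, rfl⟩

theorem IsStraightAt.exists_smul_eq {K : Set E3} {x v v' : E3} (h : IsStraightAt K x v)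
    (h' : IsStraightAt K x v') : ∃ c : ℝ, c ≠ 0 ∧ v' = c • v := by
  obtain ⟨-, ε, hε, h⟩ := h
  have h1 := (tendsto_ray x v').eventually (Metric.ball_mem_nhds x hε)
  have h2 := (h1.and h'.eventually_mem).filter_mono (nhdsWithin_le_nhds (s := Ioi 0))
  obtain ⟨t, ⟨ht1, ht2⟩, ht0⟩ := (h2.and self_mem_nhdsWithin).exists
  have ht0 : (0 : ℝ) < t := ht0
  obtain ⟨s, hs⟩ := (h _ ht1).1 ht2
  have hs' : t • v' = s • v := add_left_cancel hs
  have hv' : v' = (s / t) • v := by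
    rw [div_eq_inv_mul, mul_smul, ← hs', smul_smul, inv_mul_cancel₀ ht0.ne', one_smul]
  refine ⟨s / t, fun h0 => h'.1 ?_, hv'⟩
  rw [hv', h0, zero_smul]

theorem IsStraightAt.congr {K K' : Set E3} {x v : E3} (h : IsStraightAt K x v)
    (hK : ∀ᶠ y in 𝓝 x, (y ∈ K' ↔ y ∈ K)) : IsStraightAt K' x v := by
  obtain ⟨hv, ε, hε, h⟩ := h
  obtain ⟨δ, hδ, hK⟩ := Metric.eventually_nhds_iff_ball.1 hK
  refine ⟨hv, min ε δ, lt_min hε hδ, fun y hy => ?_⟩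
  rw [hK y (Metric.ball_subset_ball (min_le_right _ _) hy),
    h y (Metric.ball_subset_ball (min_le_left _ _) hy)]

/-! ### Linear coordinates at a crossing -/

/-- Linear coordinates near a crossing of a link `K`, in which the upper strand is the line
`y = 0, z = 1`, and the lower one is the line `x = 0, z = 0`. -/
structure CrossingChart (K : Set E3) where
  L : E3 ≃L[ℝ] ℝ × ℝ × ℝ
  origin : E3
  proj_eq_zero : ∀ v, proj v = 0 ↔ (L v).1 = 0 ∧ (L v).2.1 = 0
  height : ∀ v, proj v = 0 → (0 < v 2 ↔ 0 < (L v).2.2)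
  mem_iff' : ∀ q, |(L (q - origin)).1| ≤ 4 → |(L (q - origin)).2.1| ≤ 4 →
    (q ∈ K ↔ ((L (q - origin)).2.1 = 0 ∧ (L (q - origin)).2.2 = 1) ∨
      ((L (q - origin)).1 = 0 ∧ (L (q - origin)).2.2 = 0))
  hasEdge' : HasEdge K (origin + L.symm (1, 0, 1)) (origin + L.symm (2, 0, 1)) ∨
    HasEdge K (origin + L.symm (2, 0, 1)) (origin + L.symm (1, 0, 1))

/-- The part of `K` outside `U` is compact, so its projection is a closed set; it misses `proj u`,
hence a ball around it. -/
theorem eventually_ball_of_proj {K : Set E3} (hK : IsCompact K) {u : E3} {U : Set E3}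
    (hU : IsOpen U) (h : ∀ y ∈ K, proj y = proj u → y ∈ U) :
    ∃ δ > 0, ∀ y ∈ K, ‖proj y - proj u‖ < δ → y ∈ U := by
  have hc : IsClosed (projL '' (K \ U)) := ((hK.diff hU).image projL.continuous).isClosed
  have hu : proj u ∈ (projL '' (K \ U))ᶜ := by
    rintro ⟨y, ⟨hy, hyU⟩, hyu⟩
    exact hyU (h y hy hyu)
  obtain ⟨δ, hδ, hball⟩ := Metric.isOpen_iff.1 hc.isOpen_compl _ hu
  refine ⟨δ, hδ, fun y hy hyd => ?_⟩
  by_contra hyU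
  exact hball (mem_ball_iff_norm.2 hyd) ⟨y, ⟨hy, hyU⟩, rfl⟩

/-- The axes are the directions of the two strands, scaled by a small `s`, and the vertical vector
`o - u`; transversality makes them independent. Since only `o` and `u` lie over the crossing,
compactness excludes any other part of the link over a small square. The second axis points along
`v`, so that the point `(0, 1, 0)` lies on the under-arc towards `u + t • v`. -/
theorem Diagram.exists_crossingChart (D : Diagram) {o u v : E3} (hou : D.IsOver o u)
    (hv : IsStraightAt D.carrier u v) {ε : ℝ} (hε : 0 < ε) :
    ∃ C : CrossingChart D.carrier, C.origin + C.L.symm (0, 0, 1) = o ∧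
      ∃ t : ℝ, 0 < t ∧ t < ε ∧ C.origin + C.L.symm (0, 1, 0) = u + t • v := by
  obtain ⟨ho, hu, hproj, hlt⟩ := hou
  have hne : o ≠ u := by rintro rfl; exact lt_irrefl _ hlt
  obtain ⟨w, v', hw, hv', hli⟩ := D.transversal o ho u hu hne hproj
  obtain ⟨k, hk, hkv⟩ := hv.exists_smul_eq hv'
  have hind : ∀ a b : ℝ, a • proj w + b • proj v = 0 → a = 0 ∧ b = 0 := by
    intro a b hab
    rw [LinearIndependent.pair_iff] at hli
    have := hli a (b / k) (by
      rw [hkv, proj_smul, smul_smul, div_mul_cancel₀ _ hk]; exact hab)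
    exact ⟨this.1, by simpa [hk] using this.2⟩
  obtain ⟨-, εo, hεo, hKo⟩ := id hw
  obtain ⟨-, εu, hεu, hKu⟩ := id hv
  obtain ⟨δ, hδ, hloc⟩ := eventually_ball_of_proj D.isPolygonalLink.isCompact (u := u)
    (U := Metric.ball o εo ∪ Metric.ball u εu) (Metric.isOpen_ball.union Metric.isOpen_ball) (by
      intro y hy hyu
      rcases D.double y hy u hu o ho hyu hproj.symm with h | h | h
      · exact Or.inr (h ▸ Metric.mem_ball_self hεu)
      · exact absurd h.symm hne
      · exact Or.inl (h ▸ Metric.mem_ball_self hεo))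
  obtain ⟨τo, hτo, hmo⟩ := Metric.eventually_nhds_iff_ball.1 hw.eventually_mem
  obtain ⟨τu, hτu, hmu⟩ := Metric.eventually_nhds_iff_ball.1 hv.eventually_mem
  obtain ⟨A, B, hAB, σ, hσ, hedge⟩ := D.isPolygonalLink.exists_hasEdge_ray (o := o) (w := w) hτo
    (fun t h0 h1 => hmo t (by rw [mem_ball_zero_iff, Real.norm_eq_abs, abs_of_pos h0]; exact h1))
  -- Both strands must stay in the link up to coordinate `4`, the base from `1` to `2` must lie in
  -- one edge, `u + s • v` must lie on the prescribed under-arc, and the square must project into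
  -- the ball of radius `δ`.
  obtain ⟨s, hs, hs1, hs2, hs3, hs4, hs5⟩ : ∃ s : ℝ, 0 < s ∧ 4 * s < τo ∧ 4 * s < τu ∧ 2 * s < σ ∧
      s < ε ∧ 4 * s * (‖proj w‖ + ‖proj v‖) < δ := by
    have h1 : ∀ (a : ℝ) {b : ℝ}, 0 < b → ∀ᶠ s in 𝓝[>] (0 : ℝ), s * a < b := by
      intro a b hb
      have : Tendsto (fun s : ℝ => s * a) (𝓝 0) (𝓝 0) := by
        have : Continuous fun s : ℝ => s * a := by fun_prop
        simpa using this.tendsto 0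
      exact (this.eventually (gt_mem_nhds hb)).filter_mono nhdsWithin_le_nhds
    obtain ⟨s, hs⟩ := ((h1 4 hτo).and ((h1 4 hτu).and ((h1 2 hσ).and ((h1 1 hε).and
      ((h1 (4 * (‖proj w‖ + ‖proj v‖)) hδ).and self_mem_nhdsWithin))))).exists
    exact ⟨s, hs.2.2.2.2.2, by linarith, by linarith, by linarith, by linarith, by linarith⟩
  let f : ℝ × ℝ × ℝ →ₗ[ℝ] E3 :=
    { toFun := fun q => q.1 • s • w + q.2.1 • s • v + q.2.2 • (o - u)
      map_add' := by intro p q; simp only [Prod.fst_add, Prod.snd_add]; module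
      map_smul' := by
        intro c q; simp only [Prod.smul_fst, Prod.smul_snd, smul_eq_mul, RingHom.id_apply]; module }
  have hf : ∀ q, f q = q.1 • s • w + q.2.1 • s • v + q.2.2 • (o - u) := fun q => rfl
  have hpf : ∀ q, proj (f q) = (q.1 * s) • proj w + (q.2.1 * s) • proj v := by
    intro q
    rw [hf, proj_add, proj_add, proj_smul, proj_smul, proj_smul, proj_smul, proj_smul, proj_sub,
      hproj, sub_self, smul_zero, add_zero, smul_smul, smul_smul]
  have hpf0 : ∀ q, proj (f q) = 0 ↔ q.1 = 0 ∧ q.2.1 = 0 := by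
    intro q
    rw [hpf]
    constructor
    · intro h
      have := hind _ _ h
      simpa [hs.ne'] using this
    · rintro ⟨h1, h2⟩
      simp [h1, h2]
  have hinj : Function.Injective f := by
    rw [injective_iff_map_eq_zero]
    intro q hq
    have h0 := (hpf0 q).1 (by rw [hq]; simp [proj, Prod.ext_iff])
    rw [hf, h0.1, h0.2] at hq
    have : q.2.2 = 0 := by simpa [sub_eq_zero, hne] using hq
    exact Prod.ext h0.1 (Prod.ext h0.2 this)
  let e : (ℝ × ℝ × ℝ) ≃ₗ[ℝ] E3 := LinearMap.linearEquivOfInjective f hinj (by simp)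
  have he : ∀ q, e q = f q := fun q => rfl
  have hsm : ∀ q, e.symm.toContinuousLinearEquiv.symm q = f q := fun q => rfl
  have hfs : ∀ p, f (e.symm.toContinuousLinearEquiv p) = p := fun p => e.apply_symm_apply p
  refine ⟨⟨e.symm.toContinuousLinearEquiv, u, ?_, ?_, ?_, ?_⟩, ?_, s, hs, hs4, ?_⟩
  · intro p
    rw [← hpf0, hfs]
  · intro p hp
    have h0 := (hpf0 (e.symm.toContinuousLinearEquiv p)).1 (by rwa [hfs])
    have h1 := hfs p
    rw [hf, h0.1, h0.2] at h1
    have h2 : p 2 = (e.symm.toContinuousLinearEquiv p).2.2 * (o 2 - u 2) := by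
      conv_lhs => rw [← h1]
      simp
    rw [h2, mul_pos_iff_of_pos_right (by linarith)]
  · intro q
    obtain ⟨r, hr⟩ : ∃ r, r = e.symm.toContinuousLinearEquiv (q - u) := ⟨_, rfl⟩
    rw [← hr]
    have hq : q = u + f r := by rw [hr, hfs]; abel
    obtain ⟨a, b, c⟩ := r
    intro ha hb
    simp only at ha hb ⊢
    have hline : ∀ {a' : ℝ}, q = o + a' • w → b = 0 ∧ c = 1 := by
      intro a' h
      have h1 : f (a, b, c) = f (a' / s, 0, 1) := by
        have : f (a, b, c) = o + a' • w - u := by rw [← h, hq]; abel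
        rw [this, hf]
        simp only [smul_smul, div_mul_cancel₀ _ hs.ne']
        module
      have := hinj h1
      simp only [Prod.mk.injEq] at this
      exact this.2
    have hline' : ∀ {b' : ℝ}, q = u + b' • v → a = 0 ∧ c = 0 := by
      intro b' h
      have h1 : f (a, b, c) = f (0, b' / s, 0) := by
        have : f (a, b, c) = b' • v := by rw [hq] at h; exact add_left_cancel h
        rw [this, hf]
        simp only [smul_smul, div_mul_cancel₀ _ hs.ne']
        module
      have := hinj h1
      simp only [Prod.mk.injEq] at this
      exact ⟨this.1, this.2.2⟩
    constructor
    · intro hqK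
      have hnear : ‖proj q - proj u‖ < δ := by
        rw [hq, proj_add, add_sub_cancel_left, hpf]
        refine (norm_add_le _ _).trans_lt (lt_of_le_of_lt ?_ hs5)
        rw [norm_smul, norm_smul, Real.norm_eq_abs, Real.norm_eq_abs, abs_mul, abs_mul,
          abs_of_pos hs]
        have h1 : |a| * s * ‖proj w‖ ≤ 4 * s * ‖proj w‖ := by gcongr
        have h2 : |b| * s * ‖proj v‖ ≤ 4 * s * ‖proj v‖ := by gcongr
        simp only; linarith
      rcases hloc q hqK hnear with h | h
      · obtain ⟨a', ha'⟩ := (hKo q h).1 hqK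
        exact Or.inl (hline ha')
      · obtain ⟨b', hb'⟩ := (hKu q h).1 hqK
        exact Or.inr (hline' hb')
    · rintro (⟨rfl, rfl⟩ | ⟨rfl, rfl⟩)
      · have : q = o + (a * s) • w := by rw [hq, hf]; module
        rw [this]
        refine hmo _ ?_
        rw [mem_ball_zero_iff, Real.norm_eq_abs, abs_mul, abs_of_pos hs]
        nlinarith
      · have : q = u + (b * s) • v := by rw [hq, hf]; module
        rw [this]
        refine hmu _ ?_
        rw [mem_ball_zero_iff, Real.norm_eq_abs, abs_mul, abs_of_pos hs]
        nlinarith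
  -- The cyclic order of the vertices may run along the strand in either direction, hence the
  -- disjunction in `hasEdge'`.
  · have e1 : u + e.symm.toContinuousLinearEquiv.symm (1, 0, 1) = o + s • w := by
      rw [hsm, hf]; module
    have e2 : u + e.symm.toContinuousLinearEquiv.symm (2, 0, 1) = o + (2 * s) • w := by
      rw [hsm, hf]; module
    rw [e1, e2]
    refine hAB.subsegment (hedge _ hs (by linarith)) (hedge _ (by linarith) (by linarith)) ?_
    intro h
    rw [← e1, ← e2, hsm, hsm] at h
    have := hinj (add_left_cancel h)
    norm_num at this
  · change u + e.symm.toContinuousLinearEquiv.symm (0, 0, 1) = o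
    rw [hsm, hf]; module
  · change u + e.symm.toContinuousLinearEquiv.symm (0, 1, 0) = u + s • v
    rw [hsm, hf]; module

namespace CrossingChart

variable {K : Set E3} (C : CrossingChart K)

/-- The first coordinate. -/
def x (p : E3) : ℝ := (C.L (p - C.origin)).1

/-- The second coordinate. -/
def y (p : E3) : ℝ := (C.L (p - C.origin)).2.1

/-- The third coordinate, the height. -/
def z (p : E3) : ℝ := (C.L (p - C.origin)).2.2

/-- The point with given coordinates. -/
def pt (a b c : ℝ) : E3 := C.origin + C.L.symm (a, b, c)

@[simp] theorem x_pt (a b c : ℝ) : C.x (C.pt a b c) = a := by simp [x, pt]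

@[simp] theorem y_pt (a b c : ℝ) : C.y (C.pt a b c) = b := by simp [y, pt]

@[simp] theorem z_pt (a b c : ℝ) : C.z (C.pt a b c) = c := by simp [z, pt]

theorem eq_pt {p : E3} {a b c : ℝ} (hx : C.x p = a) (hy : C.y p = b) (hz : C.z p = c) :
    p = C.pt a b c := by
  subst hx hy hz
  change p = C.origin + C.L.symm (C.L (p - C.origin))
  rw [C.L.symm_apply_apply]
  abel

theorem ext_coords {p q : E3} (hx : C.x p = C.x q) (hy : C.y p = C.y q) (hz : C.z p = C.z q) :
    p = q :=
  (C.eq_pt hx hy hz).trans (C.eq_pt rfl rfl rfl).symm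

@[fun_prop] theorem continuous_x : Continuous C.x := by unfold x; fun_prop

@[fun_prop] theorem continuous_y : Continuous C.y := by unfold y; fun_prop

@[fun_prop] theorem continuous_z : Continuous C.z := by unfold z; fun_prop

theorem continuous_pt : Continuous fun q : ℝ × ℝ × ℝ => C.pt q.1 q.2.1 q.2.2 := by
  unfold pt
  exact continuous_const.add C.L.symm.continuous

theorem coords_add_smul (p v : E3) (t : ℝ) : C.x (p + t • v) = C.x p + t * (C.L v).1 ∧
    C.y (p + t • v) = C.y p + t * (C.L v).2.1 ∧ C.z (p + t • v) = C.z p + t * (C.L v).2.2 := by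
  have : p + t • v - C.origin = (p - C.origin) + t • v := by abel
  simp [x, y, z, this]

theorem coords_lineMap (p q : E3) (t : ℝ) :
    C.x (AffineMap.lineMap p q t) = C.x p + t * (C.x q - C.x p) ∧
    C.y (AffineMap.lineMap p q t) = C.y p + t * (C.y q - C.y p) ∧
    C.z (AffineMap.lineMap p q t) = C.z p + t * (C.z q - C.z p) := by
  have : AffineMap.lineMap p q t - C.origin =
      (p - C.origin) + t • ((q - C.origin) - (p - C.origin)) := by
    simp only [AffineMap.lineMap_apply_module]; module
  unfold x y z
  rw [this, map_add, map_smul, map_sub]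
  simp

theorem proj_eq_iff {p q : E3} : proj p = proj q ↔ C.x p = C.x q ∧ C.y p = C.y q := by
  rw [← sub_eq_zero, ← proj_sub, C.proj_eq_zero]
  have : p - q = (p - C.origin) - (q - C.origin) := by abel
  rw [this, map_sub]
  simp [x, y, sub_eq_zero]

theorem lt_iff {p q : E3} (h : proj p = proj q) : p 2 < q 2 ↔ C.z p < C.z q := by
  have h1 := C.height (q - p) (by rw [proj_sub, h, sub_self])
  have : q - p = (q - C.origin) - (p - C.origin) := by abel
  rw [this, map_sub, ← this] at h1
  simpa [z] using h1

theorem mem_iff {q : E3} (hx : |C.x q| ≤ 4) (hy : |C.y q| ≤ 4) :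
    q ∈ K ↔ (C.y q = 0 ∧ C.z q = 1) ∨ (C.x q = 0 ∧ C.z q = 0) :=
  C.mem_iff' q hx hy

theorem over_mem {t : ℝ} (ht : |t| ≤ 4) : C.pt t 0 1 ∈ K :=
  (C.mem_iff (by simpa) (by simp)).2 (by simp)

theorem under_mem {t : ℝ} (ht : |t| ≤ 4) : C.pt 0 t 0 ∈ K :=
  (C.mem_iff (by simp) (by simpa)).2 (by simp)

/-! ### Geometry of the detour -/

/-- The detour of the upper strand below the lower one. -/
def detour : Set E3 :=
  {p | 0 ≤ C.y p ∧ C.y p ≤ 3 ∧ C.z p = 1 - C.y p ∧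
    (3 * C.x p = 3 - 2 * C.y p ∨ C.x p = 2 - C.y p)}

/-- The piece of the upper strand that the detour replaces. -/
def piece : Set E3 := {p | 1 ≤ C.x p ∧ C.x p ≤ 2 ∧ C.y p = 0 ∧ C.z p = 1}

theorem segment_piece : segment ℝ (C.pt 1 0 1) (C.pt 2 0 1) = C.piece := by
  rw [segment_eq_image_lineMap]
  ext p
  simp only [mem_image, mem_Icc, piece, mem_ofPred_eq]
  constructor
  · rintro ⟨t, ⟨h0, h1⟩, rfl⟩
    obtain ⟨ex, ey, ez⟩ := C.coords_lineMap (C.pt 1 0 1) (C.pt 2 0 1) t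
    rw [ex, ey, ez]; simp; constructor <;> linarith
  · rintro ⟨h1, h2, h3, h4⟩
    refine ⟨C.x p - 1, ⟨by linarith, by linarith⟩, ?_⟩
    obtain ⟨ex, ey, ez⟩ := C.coords_lineMap (C.pt 1 0 1) (C.pt 2 0 1) (C.x p - 1)
    apply C.ext_coords <;> simp [ex, ey, ez] <;> linarith

theorem segment_left : segment ℝ (C.pt 1 0 1) (C.pt (-1) 3 (-2)) =
    {p | 0 ≤ C.y p ∧ C.y p ≤ 3 ∧ C.z p = 1 - C.y p ∧ 3 * C.x p = 3 - 2 * C.y p} := by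
  rw [segment_eq_image_lineMap]
  ext p
  simp only [mem_image, mem_Icc, mem_ofPred_eq]
  constructor
  · rintro ⟨t, ⟨h0, h1⟩, rfl⟩
    obtain ⟨ex, ey, ez⟩ := C.coords_lineMap (C.pt 1 0 1) (C.pt (-1) 3 (-2)) t
    rw [ex, ey, ez]; simp only [x_pt, y_pt, z_pt]
    refine ⟨?_, ?_, ?_, ?_⟩ <;> linarith
  · rintro ⟨h1, h2, h3, h4⟩
    refine ⟨C.y p / 3, ⟨by linarith, by linarith⟩, ?_⟩
    obtain ⟨ex, ey, ez⟩ := C.coords_lineMap (C.pt 1 0 1) (C.pt (-1) 3 (-2)) (C.y p / 3)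
    apply C.ext_coords <;> simp only [ex, ey, ez, x_pt, y_pt, z_pt] <;> linarith

theorem segment_right : segment ℝ (C.pt (-1) 3 (-2)) (C.pt 2 0 1) =
    {p | 0 ≤ C.y p ∧ C.y p ≤ 3 ∧ C.z p = 1 - C.y p ∧ C.x p = 2 - C.y p} := by
  rw [segment_eq_image_lineMap]
  ext p
  simp only [mem_image, mem_Icc, mem_ofPred_eq]
  constructor
  · rintro ⟨t, ⟨h0, h1⟩, rfl⟩
    obtain ⟨ex, ey, ez⟩ := C.coords_lineMap (C.pt (-1) 3 (-2)) (C.pt 2 0 1) t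
    rw [ex, ey, ez]; simp only [x_pt, y_pt, z_pt]
    refine ⟨?_, ?_, ?_, ?_⟩ <;> linarith
  · rintro ⟨h1, h2, h3, h4⟩
    refine ⟨1 - C.y p / 3, ⟨by linarith, by linarith⟩, ?_⟩
    obtain ⟨ex, ey, ez⟩ := C.coords_lineMap (C.pt (-1) 3 (-2)) (C.pt 2 0 1) (1 - C.y p / 3)
    apply C.ext_coords <;> simp only [ex, ey, ez, x_pt, y_pt, z_pt] <;> linarith

theorem segment_detour : segment ℝ (C.pt 1 0 1) (C.pt (-1) 3 (-2)) ∪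
    segment ℝ (C.pt (-1) 3 (-2)) (C.pt 2 0 1) = C.detour := by
  rw [C.segment_left, C.segment_right]
  ext p
  simp only [detour, mem_union, mem_ofPred_eq]
  tauto

/-- The triangle swept by the push. -/
def triangle : Set E3 :=
  {p | 0 ≤ C.y p ∧ C.z p = 1 - C.y p ∧ 3 - 2 * C.y p ≤ 3 * C.x p ∧ C.x p ≤ 2 - C.y p}

theorem convex_triangle : Convex ℝ C.triangle := by
  rw [convex_iff_segment_subset]
  rintro p ⟨h1, h2, h3, h4⟩ q ⟨h1', h2', h3', h4'⟩
  rw [segment_eq_image_lineMap]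
  rintro _ ⟨t, ⟨ht0, ht1⟩, rfl⟩
  obtain ⟨ex, ey, ez⟩ := C.coords_lineMap p q t
  simp only [triangle, mem_ofPred_eq, ex, ey, ez]
  have ht1' : 0 ≤ 1 - t := by linarith
  refine ⟨?_, ?_, ?_, ?_⟩
  · linarith [mul_nonneg ht0 h1', mul_nonneg ht1' h1]
  · rw [h2, h2']; ring
  · linarith [mul_le_mul_of_nonneg_left h3 ht1', mul_le_mul_of_nonneg_left h3' ht0]
  · linarith [mul_le_mul_of_nonneg_left h4 ht1', mul_le_mul_of_nonneg_left h4' ht0]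

theorem detour_box {p : E3} (hp : p ∈ C.detour) : |C.x p| ≤ 4 ∧ |C.y p| ≤ 4 := by
  obtain ⟨h1, h2, h3, h4⟩ := hp
  refine ⟨abs_le.2 ?_, abs_le.2 ⟨by linarith, by linarith⟩⟩
  rcases h4 with h4 | h4 <;> constructor <;> linarith

theorem piece_subset : C.piece ⊆ K := by
  rintro p ⟨h1, h2, h3, h4⟩
  exact (C.mem_iff (abs_le.2 ⟨by linarith, by linarith⟩) (by simp [h3])).2 (Or.inl ⟨h3, h4⟩)

theorem eq_of_mem_detour {p : E3} (hp : p ∈ C.detour) (hy : C.y p = 0) :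
    p = C.pt 1 0 1 ∨ p = C.pt 2 0 1 := by
  obtain ⟨h1, h2, h3, h4 | h4⟩ := hp
  · exact Or.inl (C.eq_pt (by linarith) hy (by linarith))
  · exact Or.inr (C.eq_pt (by linarith) hy (by linarith))

/-- The detour lies in the plane `z = 1 - y`, which meets the lower strand only at `y = 1`; there
the two legs have `x = 1/3` and `x = 1`, not `0`. -/
theorem eq_of_mem_detour_of_mem {p : E3} (hp : p ∈ C.detour) (hK : p ∈ K) :
    p = C.pt 1 0 1 ∨ p = C.pt 2 0 1 := by
  rw [C.mem_iff (C.detour_box hp).1 (C.detour_box hp).2] at hK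
  rcases hK with ⟨h, h'⟩ | ⟨h, h'⟩
  · exact C.eq_of_mem_detour hp h
  · obtain ⟨h1, h2, h3, h4⟩ := hp
    exfalso; rcases h4 with h4 | h4 <;> linarith

theorem pt_one_mem_piece : C.pt 1 0 1 ∈ C.piece := by norm_num [piece]

theorem pt_two_mem_piece : C.pt 2 0 1 ∈ C.piece := by norm_num [piece]

/-- The link in which the upper strand takes the detour. -/
def pushed : Set E3 := (K \ C.piece) ∪ C.detour

theorem isPolygonalLink_pushed : IsPolygonalLink C.pushed := by
  have h12 : C.pt 1 0 1 ≠ C.pt 2 0 1 := fun h => by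
    have := congrArg C.x h
    norm_num at this
  have h13 : C.pt 1 0 1 ≠ C.pt (-1) 3 (-2) := fun h => by
    have := congrArg C.x h
    norm_num at this
  have h32 : C.pt (-1) 3 (-2) ≠ C.pt 2 0 1 := fun h => by
    have := congrArg C.x h
    norm_num at this
  have hR : ∀ p ∈ segment ℝ (C.pt 1 0 1) (C.pt (-1) 3 (-2)),
      p ∈ segment ℝ (C.pt (-1) 3 (-2)) (C.pt 2 0 1) → p = C.pt (-1) 3 (-2) := by
    rw [C.segment_left, C.segment_right]
    rintro p ⟨h1, h2, h3, h4⟩ ⟨h1', h2', h3', h4'⟩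
    exact C.eq_pt (by linarith) (by linarith) (by linarith)
  have hK : ∀ p ∈ segment ℝ (C.pt 1 0 1) (C.pt (-1) 3 (-2)) ∪
      segment ℝ (C.pt (-1) 3 (-2)) (C.pt 2 0 1), p ∈ K → p = C.pt 1 0 1 ∨ p = C.pt 2 0 1 := by
    rw [C.segment_detour]
    exact fun p => C.eq_of_mem_detour_of_mem
  rcases C.hasEdge' with h | h
  · have := HasEdge.detour_of_inter h h12 h13 h32 hR hK
    rwa [← pt, ← pt, C.segment_piece, C.segment_detour] at this
  · have := HasEdge.detour_of_inter (R := C.pt (-1) 3 (-2)) h h12.symm h32.symm h13.symm ?_ ?_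
    · rwa [← pt, ← pt, segment_symm ℝ (C.pt 2 0 1) (C.pt 1 0 1), C.segment_piece,
        segment_symm ℝ (C.pt 2 0 1) (C.pt (-1) 3 (-2)),
        segment_symm ℝ (C.pt (-1) 3 (-2)) (C.pt 1 0 1), union_comm (segment ℝ _ _),
        C.segment_detour] at this
    · intro p hp hp'
      rw [segment_symm] at hp hp'
      exact hR p hp' hp
    · intro p hp hpK
      rw [← pt, ← pt, segment_symm ℝ (C.pt 2 0 1) (C.pt (-1) 3 (-2)),
        segment_symm ℝ (C.pt (-1) 3 (-2)) (C.pt 1 0 1), union_comm] at hp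
      exact (hK p hp hpK).symm

/-- On the detour the height is a function of `y`, so the detour has no crossing with itself. -/
theorem detour_eq_of_proj_eq {p q : E3} (hp : p ∈ C.detour) (hq : q ∈ C.detour)
    (h : proj p = proj q) : p = q := by
  obtain ⟨hx, hy⟩ := C.proj_eq_iff.1 h
  exact C.ext_coords hx hy (by rw [hp.2.2.1, hq.2.2.1, hy])

/-- Over the detour, there is only the lower strand. -/
theorem coords_of_proj_eq_detour {p q : E3} (hp : p ∈ C.detour) (hq : q ∈ C.pushed)
    (hqd : q ∉ C.detour) (h : proj p = proj q) :
    C.x p = 0 ∧ C.x q = 0 ∧ C.z q = 0 ∧ C.z p < 0 := by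
  obtain ⟨hx, hy⟩ := C.proj_eq_iff.1 h
  have hqK := (hq.resolve_right hqd).1
  have hbox := C.detour_box hp
  rw [hx, hy] at hbox
  rw [C.mem_iff hbox.1 hbox.2] at hqK
  rcases hqK with ⟨h1, h2⟩ | ⟨h1, h2⟩
  · rw [h1] at hy
    have hz : C.z p = C.z q := by rw [hp.2.2.1, h2, hy]; ring
    exact absurd (C.ext_coords hx (hy.trans h1.symm) hz ▸ hp) hqd
  · refine ⟨hx.trans h1, h1, h2, ?_⟩
    obtain ⟨h1', h2', h3', h4'⟩ := hp
    rcases h4' with h | h <;> linarith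

theorem isClosed_detour : IsClosed C.detour := by
  have h1 : IsClosed {p | 0 ≤ C.y p} := isClosed_le (by fun_prop) (by fun_prop)
  have h2 : IsClosed {p | C.y p ≤ 3} := isClosed_le (by fun_prop) (by fun_prop)
  have h3 : IsClosed {p | C.z p = 1 - C.y p} := isClosed_eq (by fun_prop) (by fun_prop)
  have h4 : IsClosed {p | 3 * C.x p = 3 - 2 * C.y p} := isClosed_eq (by fun_prop) (by fun_prop)
  have h5 : IsClosed {p | C.x p = 2 - C.y p} := isClosed_eq (by fun_prop) (by fun_prop)
  exact h1.inter (h2.inter (h3.inter (h4.union h5)))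

theorem isClosed_piece : IsClosed C.piece := by
  have h1 : IsClosed {p | 1 ≤ C.x p} := isClosed_le (by fun_prop) (by fun_prop)
  have h2 : IsClosed {p | C.x p ≤ 2} := isClosed_le (by fun_prop) (by fun_prop)
  have h3 : IsClosed {p | C.y p = 0} := isClosed_eq (by fun_prop) (by fun_prop)
  have h4 : IsClosed {p | C.z p = 1} := isClosed_eq (by fun_prop) (by fun_prop)
  exact h1.inter (h2.inter (h3.inter h4))

theorem eventually_mem_pushed_iff {p : E3} (hp : p ∈ C.pushed) (hpd : p ∉ C.detour) :
    ∀ᶠ q in 𝓝 p, (q ∈ C.pushed ↔ q ∈ K) ∧ q ∉ C.detour := by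
  have hpp : p ∉ C.piece := (hp.resolve_right hpd).2
  filter_upwards [C.isClosed_detour.isOpen_compl.mem_nhds hpd,
    C.isClosed_piece.isOpen_compl.mem_nhds hpp] with q hq hq'
  exact ⟨⟨fun h => (h.resolve_right hq).1, fun h => Or.inl ⟨h, hq'⟩⟩, hq⟩

theorem isStraightAt_pushed {p v : E3} (hp : p ∈ C.pushed) (hpd : p ∉ C.detour)  :
    IsStraightAt C.pushed p v ↔ IsStraightAt K p v :=
  ⟨fun h => h.congr ((C.eventually_mem_pushed_iff hp hpd).mono fun _ h => h.1.symm),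
    fun h => h.congr ((C.eventually_mem_pushed_iff hp hpd).mono fun _ h => h.1)⟩

/-- A set that, near a point, is a line in terms of coordinates. -/
theorem isStraightAt_of_coords {S : Set E3} {p : E3} {a b c : ℝ} (h0 : (a, b, c) ≠ 0)
    (h : ∀ᶠ q in 𝓝 p, (q ∈ S ↔
      ∃ t : ℝ, C.x q = C.x p + t * a ∧ C.y q = C.y p + t * b ∧ C.z q = C.z p + t * c)) :
    IsStraightAt S p (C.L.symm (a, b, c)) := by
  obtain ⟨ε, hε, h⟩ := Metric.eventually_nhds_iff_ball.1 h
  refine ⟨by simpa using h0, ε, hε, fun q hq => ?_⟩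
  rw [h q hq]
  refine exists_congr fun t => ?_
  obtain ⟨hx, hy, hz⟩ := C.coords_add_smul p (C.L.symm (a, b, c)) t
  rw [C.L.apply_symm_apply] at hx hy hz
  constructor
  · rintro ⟨h1, h2, h3⟩
    exact C.ext_coords (h1.trans hx.symm) (h2.trans hy.symm) (h3.trans hz.symm)
  · rintro rfl
    exact ⟨hx, hy, hz⟩

theorem isStraightAt_under {p : E3} (hx : C.x p = 0) (hy : |C.y p| < 4) (hz : C.z p = 0) :
    IsStraightAt K p (C.L.symm (0, 1, 0)) := by
  refine C.isStraightAt_of_coords (by simp) ?_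
  have h1 : ∀ᶠ q in 𝓝 p, |C.x q| < 4 := by
    have : Continuous fun q => |C.x q| := by fun_prop
    exact this.continuousAt.eventually (gt_mem_nhds (by simp [hx]))
  have h2 : ∀ᶠ q in 𝓝 p, |C.y q| < 4 := by
    have : Continuous fun q => |C.y q| := by fun_prop
    exact this.continuousAt.eventually (gt_mem_nhds hy)
  have h3 : ∀ᶠ q in 𝓝 p, C.z q < 1 := by
    exact C.continuous_z.continuousAt.eventually (gt_mem_nhds (by simp [hz]))
  filter_upwards [h1, h2, h3] with q h1 h2 h3
  rw [C.mem_iff h1.le h2.le]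
  simp only [hx, hz, mul_zero, mul_one, add_zero]
  constructor
  · rintro (h | h)
    · exact absurd h.2 h3.ne
    · exact ⟨C.y q - C.y p, h.1, by ring, h.2⟩
  · rintro ⟨t, h, -, h'⟩
    exact Or.inr ⟨h, h'⟩

theorem mem_pushed_iff_of_box {q : E3} (hx : |C.x q| ≤ 4) (hy : |C.y q| ≤ 4) (hz : C.z q < 0) :
    q ∈ C.pushed ↔ q ∈ C.detour := by
  refine ⟨fun h => ?_, Or.inr⟩
  by_contra hd
  rcases (C.mem_iff hx hy).1 (h.resolve_right hd).1 with h | h <;> linarith [h.2]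

/-- The crossing points of the detour below the lower strand. -/
theorem eq_of_mem_detour_of_x_eq_zero {p : E3} (hp : p ∈ C.detour) (hx : C.x p = 0) :
    p = C.pt 0 (3 / 2) (-1 / 2) ∨ p = C.pt 0 2 (-1) := by
  obtain ⟨h1, h2, h3, h4 | h4⟩ := hp
  · exact Or.inl (C.eq_pt hx (by linarith) (by linarith))
  · exact Or.inr (C.eq_pt hx (by linarith) (by linarith))

theorem isStraightAt_left :
    IsStraightAt C.pushed (C.pt 0 (3 / 2) (-1 / 2)) (C.L.symm (-2, 3, -3)) := by
  refine C.isStraightAt_of_coords (by simp) ?_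
  -- The windows are small enough to exclude the other leg, and `z < 0` excludes both original
  -- strands.
  have h1 : ∀ᶠ q in 𝓝 (C.pt 0 (3 / 2) (-1 / 2)), C.x q ∈ Ioo (-1 / 10) (1 / 10) :=
    C.continuous_x.continuousAt.eventually (Ioo_mem_nhds (by norm_num) (by norm_num))
  have h2 : ∀ᶠ q in 𝓝 (C.pt 0 (3 / 2) (-1 / 2)), C.y q ∈ Ioo (14 / 10) (16 / 10) :=
    C.continuous_y.continuousAt.eventually (Ioo_mem_nhds (by norm_num) (by norm_num))
  have h3 : ∀ᶠ q in 𝓝 (C.pt 0 (3 / 2) (-1 / 2)), C.z q ∈ Iio 0 :=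
    C.continuous_z.continuousAt.eventually (Iio_mem_nhds (by norm_num))
  filter_upwards [h1, h2, h3] with q h1 h2 h3
  rw [C.mem_pushed_iff_of_box (abs_le.2 ⟨by linarith [h1.1], by linarith [h1.2]⟩)
    (abs_le.2 ⟨by linarith [h2.1], by linarith [h2.2]⟩) h3]
  simp only [x_pt, y_pt, z_pt, detour, mem_ofPred_eq]
  constructor
  · rintro ⟨-, -, hz, h | h⟩
    · exact ⟨-C.x q / 2, by ring, by linarith, by linarith⟩
    · linarith [h1.2, h2.2]
  · rintro ⟨t, e1, e2, e3⟩
    exact ⟨by linarith [h2.1], by linarith [h2.2], by linarith, Or.inl (by linarith)⟩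

theorem isStraightAt_right :
    IsStraightAt C.pushed (C.pt 0 2 (-1)) (C.L.symm (-3, 3, -3)) := by
  refine C.isStraightAt_of_coords (by simp) ?_
  have h1 : ∀ᶠ q in 𝓝 (C.pt 0 2 (-1)), C.x q ∈ Ioo (-1 / 10) (1 / 10) :=
    C.continuous_x.continuousAt.eventually (Ioo_mem_nhds (by norm_num) (by norm_num))
  have h2 : ∀ᶠ q in 𝓝 (C.pt 0 2 (-1)), C.y q ∈ Ioo (19 / 10) (21 / 10) :=
    C.continuous_y.continuousAt.eventually (Ioo_mem_nhds (by norm_num) (by norm_num))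
  have h3 : ∀ᶠ q in 𝓝 (C.pt 0 2 (-1)), C.z q ∈ Iio 0 :=
    C.continuous_z.continuousAt.eventually (Iio_mem_nhds (by norm_num))
  filter_upwards [h1, h2, h3] with q h1 h2 h3
  rw [C.mem_pushed_iff_of_box (abs_le.2 ⟨by linarith [h1.1], by linarith [h1.2]⟩)
    (abs_le.2 ⟨by linarith [h2.1], by linarith [h2.2]⟩) h3]
  simp only [x_pt, y_pt, z_pt, detour, mem_ofPred_eq]
  constructor
  · rintro ⟨-, -, hz, h | h⟩
    · linarith [h1.1, h2.1]
    · exact ⟨-C.x q / 3, by ring, by linarith, by linarith⟩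
  · rintro ⟨t, e1, e2, e3⟩
    exact ⟨by linarith [h2.1], by linarith [h2.2], by linarith, Or.inr (by linarith)⟩

/-- At its crossing points, the detour is straight and leads to the left. -/
theorem exists_isStraightAt_detour {p : E3} (hp : p ∈ C.detour) (hx : C.x p = 0) :
    ∃ v, IsStraightAt C.pushed p v ∧ (C.L v).1 < 0 := by
  rcases C.eq_of_mem_detour_of_x_eq_zero hp hx with rfl | rfl
  · exact ⟨_, C.isStraightAt_left, by simp⟩
  · exact ⟨_, C.isStraightAt_right, by simp⟩

end CrossingChart

/-! ### The pushed diagram -/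

/-- The diagram in which, near a crossing, the upper strand takes a detour below the lower one. -/
def Diagram.push (D : Diagram) (C : CrossingChart D.carrier) : Diagram where
  carrier := C.pushed
  isPolygonalLink := C.isPolygonalLink_pushed
  double := by
    -- Two points off the detour that share the projection of one of its points both lie on the
    -- lower strand at height `0`, so they coincide.
    have key : ∀ p ∈ C.detour, ∀ q ∈ C.pushed, ∀ r ∈ C.pushed, proj p = proj q → proj p = proj r →
        p = q ∨ q = r ∨ p = r := by
      intro p hp q hq r hr hpq hpr
      by_cases hqd : q ∈ C.detour
      · exact Or.inl (C.detour_eq_of_proj_eq hp hqd hpq)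
      by_cases hrd : r ∈ C.detour
      · exact Or.inr (Or.inr (C.detour_eq_of_proj_eq hp hrd hpr))
      have h1 := C.coords_of_proj_eq_detour hp hq hqd hpq
      have h2 := C.coords_of_proj_eq_detour hp hr hrd hpr
      have h3 := C.proj_eq_iff.1 (hpq.symm.trans hpr)
      exact Or.inr (Or.inl (C.ext_coords h3.1 h3.2 (by rw [h1.2.2.1, h2.2.2.1])))
    intro p hp q hq r hr hpq hqr
    by_cases hpd : p ∈ C.detour
    · exact key p hpd q hq r hr hpq (hpq.trans hqr)
    by_cases hqd : q ∈ C.detour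
    · have := key q hqd r hr p hp hqr hpq.symm
      tauto
    by_cases hrd : r ∈ C.detour
    · have := key r hrd p hp q hq (hpq.trans hqr).symm hqr.symm
      tauto
    exact D.double p (hp.resolve_right hpd).1 q (hq.resolve_right hqd).1 r
      (hr.resolve_right hrd).1 hpq hqr
  transversal := by
    have key : ∀ p ∈ C.detour, ∀ q ∈ C.pushed, p ≠ q → proj p = proj q →
        ∃ u v : E3, IsStraightAt C.pushed p u ∧ IsStraightAt C.pushed q v ∧
          LinearIndependent ℝ ![proj u, proj v] := by
      intro p hp q hq hne hpq
      have hqd : q ∉ C.detour := fun hqd => hne (C.detour_eq_of_proj_eq hp hqd hpq)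
      obtain ⟨h1, h2, h3, -⟩ := C.coords_of_proj_eq_detour hp hq hqd hpq
      obtain ⟨v, hv, hv0⟩ := C.exists_isStraightAt_detour hp h1
      refine ⟨v, _, hv, (C.isStraightAt_pushed hq hqd).2 (C.isStraightAt_under h2 ?_ h3), ?_⟩
      · rw [← (C.proj_eq_iff.1 hpq).2, abs_lt]
        exact ⟨by linarith [hp.1], by linarith [hp.2.1]⟩
      -- The lower strand has direction `(0, 1, 0)`, while the detour has nonzero first component.
      · rw [LinearIndependent.pair_iff]
        intro a b hab
        rw [← proj_smul, ← proj_smul, ← proj_add, C.proj_eq_zero] at hab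
        simp only [map_add, map_smul, C.L.apply_symm_apply] at hab
        simp only [Prod.fst_add, Prod.smul_fst, Prod.snd_add, Prod.smul_snd, smul_eq_mul, mul_zero,
          add_zero, mul_one, mul_eq_zero, hv0.ne, or_false] at hab
        obtain ⟨rfl, h⟩ := hab
        exact ⟨rfl, by simpa using h⟩
    intro p hp q hq hne hpq
    by_cases hpd : p ∈ C.detour
    · exact key p hpd q hq hne hpq
    by_cases hqd : q ∈ C.detour
    · obtain ⟨u, v, hu, hv, huv⟩ := key q hqd p hp hne.symm hpq.symm
      exact ⟨v, u, hv, hu, LinearIndependent.pair_symm_iff.1 huv⟩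
    obtain ⟨u, v, hu, hv, huv⟩ := D.transversal p (hp.resolve_right hpd).1 q
      (hq.resolve_right hqd).1 hne hpq
    exact ⟨u, v, (C.isStraightAt_pushed hp hpd).2 hu, (C.isStraightAt_pushed hq hqd).2 hv, huv⟩

/-- The triangle lies in the plane `z = 1 - y`. It misses the lower strand, since at `y = 1` it has
`x ≥ 1/3`, and it meets the upper strand only in its base. -/
theorem Diagram.triangleMove_push (D : Diagram) (C : CrossingChart D.carrier) :
    TriangleMove D.toLink (D.push C).toLink := by
  refine ⟨C.pt 1 0 1, C.pt 2 0 1, C.pt (-1) 3 (-2), ?_, ?_, ?_⟩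
  · rw [affineIndependent_iff_not_collinear_set,
      collinear_iff_of_mem (Set.mem_insert (C.pt 1 0 1) _)]
    rintro ⟨v, hv⟩
    obtain ⟨r, hr⟩ := hv (C.pt 2 0 1) (by simp)
    obtain ⟨s, hs⟩ := hv (C.pt (-1) 3 (-2)) (by simp)
    rw [vadd_eq_add, add_comm] at hr hs
    obtain ⟨hx, hy, -⟩ := C.coords_add_smul (C.pt 1 0 1) v r
    obtain ⟨-, hy', -⟩ := C.coords_add_smul (C.pt 1 0 1) v s
    rw [← hr] at hx hy
    rw [← hs] at hy'
    simp only [C.x_pt, C.y_pt, zero_add] at hx hy hy'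
    rcases mul_eq_zero.1 hy.symm with h | h
    · rw [h] at hx; norm_num at hx
    · rw [h] at hy'; norm_num at hy'
  · rw [C.segment_piece]
    refine subset_antisymm ?_ fun p hp => ⟨C.piece_subset hp, ?_⟩
    · rintro p ⟨hpK, hp⟩
      have hsub : {C.pt 1 0 1, C.pt 2 0 1, C.pt (-1) 3 (-2)} ⊆ C.triangle := by
        rintro q (rfl | rfl | rfl) <;> norm_num [CrossingChart.triangle]
      obtain ⟨h1, h2, h3, h4⟩ := convexHull_min hsub C.convex_triangle hp
      have hx : |C.x p| ≤ 4 := abs_le.2 ⟨by linarith, by linarith⟩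
      have hy : |C.y p| ≤ 4 := abs_le.2 ⟨by linarith, by linarith⟩
      rcases (C.mem_iff hx hy).1 hpK with ⟨h, h'⟩ | ⟨h, h'⟩
      · exact ⟨by linarith, by linarith, h, h'⟩
      · linarith
    · rw [← C.segment_piece] at hp
      exact segment_subset_convexHull (by simp) (by simp) hp
  · rw [C.segment_piece, C.segment_detour]
    rfl

theorem Diagram.IsDiagramOf.push {D : Diagram} {L : Link} (h : D.IsDiagramOf L)
    (C : CrossingChart D.carrier) : (D.push C).IsDiagramOf L :=
  .trans _ _ _ (.symm _ _ (.rel _ _ (D.triangleMove_push C))) h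

/-! ### Arcs of the pushed diagram -/

theorem eventually_ray {x v : E3} {P : E3 → Prop} (h : ∀ᶠ y in 𝓝 x, P y) :
    ∀ᶠ t : ℝ in 𝓝[>] 0, P (x - t • v) ∧ P (x + t • v) := by
  have h1 := (tendsto_ray x v).eventually h
  have h2 := (tendsto_ray x (-v)).eventually h
  filter_upwards [(h1.and h2).filter_mono nhdsWithin_le_nhds] with t ht
  exact ⟨by simpa [sub_eq_add_neg] using ht.2, ht.1⟩

namespace Diagram

variable {D : Diagram}

theorem onArc_mk {p : E3} (hp : p ∈ D.cut) : D.OnArc p (ConnectedComponents.mk ⟨p, hp⟩) := ⟨hp, rfl⟩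

theorem OnArc.unique {p : E3} {α β : D.Arc} (hα : D.OnArc p α) (hβ : D.OnArc p β) : α = β := by
  obtain ⟨h, rfl⟩ := hα
  obtain ⟨_, rfl⟩ := hβ
  rfl

theorem OnArc.of_isPreconnected {S : Set E3} (hS : IsPreconnected S) (hSD : S ⊆ D.cut) {p q : E3}
    (hp : p ∈ S) (hq : q ∈ S) {α : D.Arc} (h : D.OnArc p α) : D.OnArc q α := by
  obtain ⟨hp', rfl⟩ := h
  refine ⟨hSD hq, ?_⟩
  rw [ConnectedComponents.coe_eq_coe']
  have : IsPreconnected ((↑) ⁻¹' S : Set D.cut) := by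
    rw [← Topology.IsInducing.subtypeVal.isPreconnected_image]
    rwa [Subtype.image_preimage_coe, inter_eq_right.2 hSD]
  exact this.subset_connectedComponent (x := ⟨p, hp'⟩) hp (show (⟨q, hSD hq⟩ : D.cut) ∈ _ from hq)

end Diagram

namespace CrossingChart

variable {D : Diagram} (C : CrossingChart D.carrier)

theorem over_mem_cut {t : ℝ} (ht : |t| ≤ 4) : C.pt t 0 1 ∈ D.cut := by
  refine ⟨C.over_mem ht, ?_⟩
  rintro ⟨o, ho, -, hproj, hlt⟩
  rw [C.lt_iff hproj.symm] at hlt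
  obtain ⟨hx, hy⟩ := C.proj_eq_iff.1 hproj
  simp only [x_pt, y_pt, z_pt] at hx hy hlt
  rcases (C.mem_iff (by rwa [hx]) (by simp [hy])).1 ho with h | h <;> linarith [h.2]

theorem under_mem_cut {t : ℝ} (h0 : 0 < t) (ht : t ≤ 4) : C.pt 0 t 0 ∈ D.cut := by
  have ht' : |t| ≤ 4 := by rwa [abs_of_pos h0]
  refine ⟨C.under_mem ht', ?_⟩
  rintro ⟨o, ho, -, hproj, hlt⟩
  rw [C.lt_iff hproj.symm] at hlt
  obtain ⟨hx, hy⟩ := C.proj_eq_iff.1 hproj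
  simp only [x_pt, y_pt, z_pt] at hx hy hlt
  rcases (C.mem_iff (by simp [hx]) (by rwa [hy])).1 ho with h | h <;> linarith [h.1, h.2]

theorem over_onArc {s t : ℝ} (hs : |s| ≤ 4) (ht : |t| ≤ 4) {α : D.Arc}
    (h : D.OnArc (C.pt s 0 1) α) : D.OnArc (C.pt t 0 1) α := by
  refine h.of_isPreconnected (S := (fun r => C.pt r 0 1) '' Icc (-4) 4)
    (isPreconnected_Icc.image _ ?_) ?_ ⟨s, abs_le.1 hs, rfl⟩ ⟨t, abs_le.1 ht, rfl⟩
  · have := C.continuous_pt.comp (by fun_prop : Continuous fun r : ℝ => (r, (0 : ℝ), (1 : ℝ)))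
    exact this.continuousOn
  · rintro _ ⟨r, hr, rfl⟩
    exact C.over_mem_cut (abs_le.2 hr)

theorem under_onArc {s t : ℝ} (hs : s ∈ Ioc 0 4) (ht : t ∈ Ioc 0 4) {α : D.Arc}
    (h : D.OnArc (C.pt 0 s 0) α) : D.OnArc (C.pt 0 t 0) α := by
  refine h.of_isPreconnected (S := (fun r => C.pt 0 r 0) '' Ioc 0 4)
    (isPreconnected_Ioc.image _ ?_) ?_ ⟨s, hs, rfl⟩ ⟨t, ht, rfl⟩
  · have := C.continuous_pt.comp (by fun_prop : Continuous fun r : ℝ => ((0 : ℝ), r, (0 : ℝ)))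
    exact this.continuousOn
  · rintro _ ⟨r, hr, rfl⟩
    exact C.under_mem_cut hr.1 hr.2

theorem isOver_push_iff {o u : E3} (hu : u ∈ C.pushed) (hud : u ∉ C.detour) :
    (D.push C).IsOver o u ↔ D.IsOver o u ∧ o ∉ C.piece ∧ o ∉ C.detour := by
  constructor
  · rintro ⟨ho, -, hproj, hlt⟩
    have hod : o ∉ C.detour := by
      intro hod
      obtain ⟨-, -, hz, hz'⟩ := C.coords_of_proj_eq_detour hod hu hud hproj
      rw [C.lt_iff hproj.symm] at hlt
      linarith
    have ho' := ho.resolve_right hod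
    exact ⟨⟨ho'.1, (hu.resolve_right hud).1, hproj, hlt⟩, ho'.2, hod⟩
  · rintro ⟨⟨ho, -, hproj, hlt⟩, hop, -⟩
    exact ⟨Or.inl ⟨ho, hop⟩, hu, hproj, hlt⟩

/-- Over the square the two strands cross only at `x = y = 0`, so the piece with `1 ≤ x ≤ 2` takes
part in no crossing. Removing it therefore loses none of the old crossings. -/
theorem notMem_piece_of_isOver {o u : E3} (h : D.IsOver o u) : o ∉ C.piece ∧ o ∉ C.detour := by
  have key : o ∉ C.piece := by
    rintro ⟨h1, h2, h3, h4⟩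
    obtain ⟨ho, huK, hproj, hlt⟩ := h
    obtain ⟨hx, hy⟩ := C.proj_eq_iff.1 hproj
    rw [C.lt_iff hproj.symm] at hlt
    rcases (C.mem_iff (abs_le.2 ⟨by linarith, by linarith⟩)
      (abs_le.2 ⟨by linarith, by linarith⟩)).1 huK with h | h
    · linarith [h.2]
    · linarith [h.1]
  refine ⟨key, fun hod => key ?_⟩
  rcases C.eq_of_mem_detour_of_mem hod h.1 with rfl | rfl
  · exact C.pt_one_mem_piece
  · exact C.pt_two_mem_piece

theorem mem_cut_push_iff {p : E3} (hp : p ∈ C.pushed) (hpd : p ∉ C.detour) :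
    p ∈ (D.push C).cut ↔ p ∈ D.cut := by
  have hpK := (hp.resolve_right hpd).1
  change (p ∈ C.pushed ∧ _) ↔ (p ∈ D.carrier ∧ _)
  simp only [hp, hpK, true_and]
  refine not_congr (exists_congr fun o => ?_)
  rw [C.isOver_push_iff hp hpd]
  exact ⟨fun h => h.1, fun h => ⟨h, C.notMem_piece_of_isOver h⟩⟩

/-- The only crossings of the detour. -/
theorem isOver_push_detour {o u : E3} (hud : u ∈ C.detour) (h : (D.push C).IsOver o u) :
    C.x u = 0 ∧ o = C.pt 0 (C.y u) 0 := by
  obtain ⟨ho, -, hproj, hlt⟩ := h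
  have hod : o ∉ C.detour := by
    intro hod
    rw [C.detour_eq_of_proj_eq hod hud hproj] at hlt
    exact lt_irrefl _ hlt
  obtain ⟨h1, h2, h3, -⟩ := C.coords_of_proj_eq_detour hud ho hod hproj.symm
  exact ⟨h1, C.eq_pt h2 (C.proj_eq_iff.1 hproj).2 h3⟩

theorem under_mem_pushed {t : ℝ} (h0 : 0 < t) (ht : t ≤ 4) :
    C.pt 0 t 0 ∈ C.pushed ∧ C.pt 0 t 0 ∉ C.detour := by
  refine ⟨Or.inl ⟨C.under_mem (by rwa [abs_of_pos h0]), fun h => by have := h.1; norm_num at this⟩, ?_⟩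
  rintro ⟨-, -, h3, h4⟩
  simp only [x_pt, y_pt, z_pt] at h3 h4
  rcases h4 with h | h <;> linarith

theorem isOver_push_of_detour {u : E3} (hud : u ∈ C.detour) (hx : C.x u = 0) :
    (D.push C).IsOver (C.pt 0 (C.y u) 0) u := by
  have hy : 0 < C.y u ∧ C.z u < 0 := by
    obtain ⟨h1, h2, h3, h | h⟩ := hud <;> constructor <;> linarith
  have hproj : proj (C.pt 0 (C.y u) 0) = proj u := by rw [C.proj_eq_iff]; simp [hx]
  refine ⟨(C.under_mem_pushed hy.1 (by linarith [hud.2.1])).1, Or.inr hud, hproj, ?_⟩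
  rw [C.lt_iff hproj.symm, z_pt]
  exact hy.2

theorem x_ne_zero_of_mem_cut {p : E3} (hp : p ∈ (D.push C).cut) (hpd : p ∈ C.detour) :
    C.x p ≠ 0 :=
  fun hx => hp.2 ⟨_, C.isOver_push_of_detour hpd hx⟩

theorem mem_cut_push_of_detour {p : E3} (hpd : p ∈ C.detour) (hx : C.x p ≠ 0) :
    p ∈ (D.push C).cut :=
  ⟨Or.inr hpd, fun ⟨_, h⟩ => hx (C.isOver_push_detour hpd h).1⟩

/-- The piece of the detour on the other side of the lower strand. -/
def tip : Set E3 := {p | p ∈ C.detour ∧ C.x p < 0}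

open Classical in
/-- The map that collapses the detour to the piece of the upper strand that it replaces. -/
noncomputable def collapse (p : E3) : E3 :=
  if p ∈ C.detour then C.pt (C.x p + 2 / 3 * C.y p) 0 1 else p

theorem collapse_of_mem {p : E3} (hp : p ∈ C.detour) :
    C.collapse p = C.pt (C.x p + 2 / 3 * C.y p) 0 1 := if_pos hp

theorem collapse_of_notMem {p : E3} (hp : p ∉ C.detour) : C.collapse p = p := if_neg hp

theorem abs_collapse_le {p : E3} (hp : p ∈ C.detour) : |C.x p + 2 / 3 * C.y p| ≤ 4 := by
  obtain ⟨h1, h2, h3, h4⟩ := hp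
  rw [abs_le]
  rcases h4 with h | h <;> constructor <;> linarith

theorem collapse_mem_cut {p : E3} (hp : p ∈ (D.push C).cut) : C.collapse p ∈ D.cut := by
  by_cases hpd : p ∈ C.detour
  · rw [C.collapse_of_mem hpd]
    exact C.over_mem_cut (C.abs_collapse_le hpd)
  · rw [C.collapse_of_notMem hpd]
    exact (C.mem_cut_push_iff hp.1 hpd).1 hp

/-- On the detour, `x + 2/3 * y` is constantly `1` on the left leg and runs from `1` to `2` along
the right one, so the map fixes both ends of the detour. It is glued from two closed sets: the
detour, and the old link minus an open box that meets it just in the interior of the piece. -/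
theorem continuousOn_collapse : ContinuousOn C.collapse C.pushed := by
  have hU : IsOpen {p | (1 < C.x p ∧ C.x p < 2) ∧ (-1 < C.y p ∧ C.y p < 1) ∧ 0 < C.z p} := by
    have h1 : IsOpen {p | 1 < C.x p} := isOpen_lt (by fun_prop) (by fun_prop)
    have h2 : IsOpen {p | C.x p < 2} := isOpen_lt (by fun_prop) (by fun_prop)
    have h3 : IsOpen {p | -1 < C.y p} := isOpen_lt (by fun_prop) (by fun_prop)
    have h4 : IsOpen {p | C.y p < 1} := isOpen_lt (by fun_prop) (by fun_prop)
    have h5 : IsOpen {p | 0 < C.z p} := isOpen_lt (by fun_prop) (by fun_prop)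
    exact (h1.inter h2).inter ((h3.inter h4).inter h5)
  have hcl : IsClosed (D.carrier \
      {p | (1 < C.x p ∧ C.x p < 2) ∧ (-1 < C.y p ∧ C.y p < 1) ∧ 0 < C.z p}) :=
    (D.isPolygonalLink.isCompact.diff hU).isClosed
  have h1 : ContinuousOn C.collapse (D.carrier \
      {p | (1 < C.x p ∧ C.x p < 2) ∧ (-1 < C.y p ∧ C.y p < 1) ∧ 0 < C.z p}) := by
    refine continuousOn_id.congr fun p hp => ?_
    by_cases hpd : p ∈ C.detour
    · rw [C.collapse_of_mem hpd]
      rcases C.eq_of_mem_detour_of_mem hpd hp.1 with rfl | rfl <;> simp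
    · exact C.collapse_of_notMem hpd
  have h2 : ContinuousOn C.collapse C.detour := by
    have : Continuous fun p => C.pt (C.x p + 2 / 3 * C.y p) 0 1 := C.continuous_pt.comp
      (by fun_prop : Continuous fun p => (C.x p + 2 / 3 * C.y p, (0 : ℝ), (1 : ℝ)))
    exact this.continuousOn.congr fun p hp => C.collapse_of_mem hp
  refine (h1.union_of_isClosed h2 hcl C.isClosed_detour).mono ?_
  rintro p (⟨hp, hpp⟩ | hp)
  · refine Or.inl ⟨hp, fun h => hpp ?_⟩
    obtain ⟨⟨hx1, hx2⟩, ⟨hy1, hy2⟩, hz⟩ := h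
    rcases (C.mem_iff (abs_le.2 ⟨by linarith, by linarith⟩)
      (abs_le.2 ⟨by linarith, by linarith⟩)).1 hp with h | h
    · exact ⟨hx1.le, hx2.le, h.1, h.2⟩
    · linarith [h.2]
  · exact Or.inr hp

/-- Closed, because the points of the detour with `x = 0` are under-crossings and have been cut out,
so that `x < 0` and `x ≤ 0` agree. Open, because no other part of the link lies over `-4 < x < 0`,
`0 < y < 4`. Hence every arc is inside or outside the tip, and it need not be shown that the tip is
a single arc. -/
theorem isClopen_tip : IsClopen {p : (D.push C).cut | (p : E3) ∈ C.tip} := by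
  constructor
  · have h : IsClosed (C.detour ∩ {p | C.x p ≤ 0}) :=
      C.isClosed_detour.inter (isClosed_le (by fun_prop) (by fun_prop))
    convert h.preimage (continuous_subtype_val (p := (· ∈ (D.push C).cut))) using 1
    ext p
    refine ⟨fun h => ⟨h.1, h.2.le⟩, fun h => ⟨h.1, lt_of_le_of_ne h.2 ?_⟩⟩
    exact C.x_ne_zero_of_mem_cut p.2 h.1
  · have h : IsOpen {p | (-4 < C.x p ∧ C.x p < 0) ∧ (0 < C.y p ∧ C.y p < 4)} := by
      have h1 : IsOpen {p | -4 < C.x p} := isOpen_lt (by fun_prop) (by fun_prop)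
      have h2 : IsOpen {p | C.x p < 0} := isOpen_lt (by fun_prop) (by fun_prop)
      have h3 : IsOpen {p | 0 < C.y p} := isOpen_lt (by fun_prop) (by fun_prop)
      have h4 : IsOpen {p | C.y p < 4} := isOpen_lt (by fun_prop) (by fun_prop)
      exact (h1.inter h2).inter (h3.inter h4)
    convert h.preimage (continuous_subtype_val (p := (· ∈ (D.push C).cut))) using 1
    ext ⟨p, hp⟩
    constructor
    · rintro ⟨⟨h1, h2, h3, h4⟩, hx⟩
      refine ⟨⟨?_, hx⟩, ?_, by linarith⟩ <;> rcases h4 with h | h <;> simp only at * <;> linarith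
    · rintro ⟨⟨hx1, hx2⟩, hy1, hy2⟩
      rcases hp.1 with h | h
      · rcases (C.mem_iff (abs_le.2 ⟨hx1.le, by linarith⟩)
          (abs_le.2 ⟨by linarith, hy2.le⟩)).1 h.1 with h | h
        · exact absurd h.1 hy1.ne'
        · exact absurd h.1 hx2.ne
      · exact ⟨h, hx2⟩

/-- The map on arcs induced by collapsing the detour. -/
noncomputable def collapseArc : (D.push C).Arc → D.Arc :=
  Continuous.connectedComponentsMap
    (f := fun p : (D.push C).cut => (⟨C.collapse p, C.collapse_mem_cut p.2⟩ : D.cut)) <| by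
      refine Continuous.subtype_mk ?_ _
      exact (C.continuousOn_collapse.mono fun p hp => hp.1).domRestrict

/-- Whether an arc is the tip of the detour. -/
noncomputable def isTip : (D.push C).Arc → Bool :=
  Continuous.connectedComponentsLift
    ((continuous_boolIndicator_iff_isClopen _).2 C.isClopen_tip)

theorem isTip_of_onArc {p : E3} {α : (D.push C).Arc} (h : (D.push C).OnArc p α) :
    C.isTip α = true ↔ p ∈ C.tip := by
  obtain ⟨hp, rfl⟩ := h
  rw [isTip, Continuous.connectedComponentsLift_apply_coe]
  exact (Set.mem_iff_boolIndicator {p : (D.push C).cut | (p : E3) ∈ C.tip} ⟨p, hp⟩).symm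

theorem onArc_collapse {p : E3} {α : (D.push C).Arc} (h : (D.push C).OnArc p α) :
    D.OnArc (C.collapse p) (C.collapseArc α) := by
  obtain ⟨hp, rfl⟩ := h
  exact ⟨C.collapse_mem_cut hp, rfl⟩

theorem onArc_of_notMem {p : E3} {α : (D.push C).Arc} (h : (D.push C).OnArc p α)
    (hp : p ∉ C.detour) : D.OnArc p (C.collapseArc α) := by
  have := C.onArc_collapse h
  rwa [C.collapse_of_notMem hp] at this

/-! ### Coloring the pushed diagram -/

/-- The color that the pushed diagram gets from a coloring and a color of the tip. -/
noncomputable def pushColor {p : ℕ} (c : Coloring p D) (d : ZMod p) (α : (D.push C).Arc) : ZMod p :=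
  if C.isTip α then d else c.color (C.collapseArc α)

theorem pushColor_of_mem_tip {p : ℕ} (c : Coloring p D) (d : ZMod p) {α : (D.push C).Arc} {q : E3}
    (h : (D.push C).OnArc q α) (hq : q ∈ C.tip) : C.pushColor c d α = d :=
  if_pos ((C.isTip_of_onArc h).2 hq)

theorem pushColor_of_notMem {p : ℕ} (c : Coloring p D) (d : ZMod p) {α : (D.push C).Arc} {q : E3}
    {α' : D.Arc} (h : (D.push C).OnArc q α) (hq : q ∉ C.detour) (h' : D.OnArc q α') :
    C.pushColor c d α = c.color α' := by
  rw [pushColor, if_neg (fun ht => hq ((C.isTip_of_onArc h).1 ht).1)]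
  have := C.onArc_collapse h
  rw [C.collapse_of_notMem hq] at this
  rw [this.unique h']

theorem pushColor_of_mem_detour {p : ℕ} (c : Coloring p D) (d : ZMod p) {α : (D.push C).Arc} {q : E3}
    {β : D.Arc} (h : (D.push C).OnArc q α) (hq : q ∈ C.detour) (hx : 0 ≤ C.x q)
    (hβ : D.OnArc (C.pt 0 0 1) β) : C.pushColor c d α = c.color β := by
  rw [pushColor, if_neg (fun ht => (((C.isTip_of_onArc h).1 ht).2).not_ge hx)]
  have := C.onArc_collapse h
  rw [C.collapse_of_mem hq] at this
  rw [this.unique (C.over_onArc (by simp) (C.abs_collapse_le hq) hβ)]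

/-- A coloring extends to the pushed diagram. -/
noncomputable def pushColoring {p : ℕ} (c : Coloring p D) {β γ : D.Arc}
    (hβ : D.OnArc (C.pt 0 0 1) β) (hγ : D.OnArc (C.pt 0 1 0) γ) :
    Coloring p (D.push C) where
  -- Both new crossings have over-arc `γ` and an under-arc of color `c.color β`, so the rule forces
  -- the color of the tip.
  color := C.pushColor c (2 * c.color γ - c.color β)
  rule := by
    rintro α' β' γ' ⟨o, u, v, hou, hv, hoβ, ε, hε, hαγ⟩
    have hu : u ∈ C.pushed := hou.2.1
    have hev : ∀ {P : ℝ → Prop}, (∀ᶠ t : ℝ in 𝓝[>] 0, P t) → ∃ t ∈ Ioo 0 ε, P t := by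
      intro P h
      have h' : ∀ᶠ t in 𝓝[>] (0 : ℝ), t ∈ Ioo 0 ε := Ioo_mem_nhdsGT hε
      exact (h'.and h).exists
    by_cases hud : u ∈ C.detour
    · obtain ⟨hx, rfl⟩ := C.isOver_push_detour hud hou
      have hy : 0 < C.y u := by obtain ⟨h1, h2, h3, h | h⟩ := hud <;> linarith
      have hy' : C.y u ≤ 4 := by linarith [hud.2.1]
      have hγ' := C.under_onArc (t := C.y u) ⟨one_pos, by norm_num⟩ ⟨hy, hy'⟩ hγ
      rw [C.pushColor_of_notMem c _ hoβ (C.under_mem_pushed hy hy').2 hγ']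
      have hv0 : (C.L v).1 ≠ 0 := by
        obtain ⟨w, hw, hw0⟩ := C.exists_isStraightAt_detour hud hx
        obtain ⟨k, hk, rfl⟩ := hw.exists_smul_eq hv
        simp [hk, hw0.ne]
      have hz : C.z u < 0 := by obtain ⟨h1, h2, h3, h | h⟩ := hud <;> linarith
      have hnear : ∀ᶠ q in 𝓝 u, q ∈ C.pushed → q ∈ C.detour := by
        have h1 : ∀ᶠ q in 𝓝 u, |C.x q| < 4 := by
          have : Continuous fun q => |C.x q| := by fun_prop
          exact this.continuousAt.eventually (gt_mem_nhds (by simp [hx]))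
        have h2 : ∀ᶠ q in 𝓝 u, |C.y q| < 4 := by
          have : Continuous fun q => |C.y q| := by fun_prop
          refine this.continuousAt.eventually (gt_mem_nhds ?_)
          exact abs_lt.2 ⟨by linarith, by linarith [hud.2.1]⟩
        have h3 : ∀ᶠ q in 𝓝 u, C.z q < 0 :=
          C.continuous_z.continuousAt.eventually (gt_mem_nhds hz)
        filter_upwards [h1, h2, h3] with q h1 h2 h3
        exact (C.mem_pushed_iff_of_box h1.le h2.le h3).1
      obtain ⟨t, ht, hm, hp⟩ := hev (eventually_ray (v := v) hnear)
      obtain ⟨hA, hG⟩ := hαγ t ht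
      have hmd := hm hA.1.1
      have hpd := hp hG.1.1
      have hxp := (C.coords_add_smul u v t).1
      have hxm := (C.coords_add_smul u v (-t)).1
      rw [neg_smul, ← sub_eq_add_neg] at hxm
      rw [hx] at hxp hxm
      -- The direction `v` is only determined up to a nonzero factor; the sign of its first
      -- component tells which side is the tip.
      rcases hv0.lt_or_gt with h | h
      · have := mul_neg_of_pos_of_neg ht.1 h
        rw [C.pushColor_of_mem_detour c _ hA hmd (by linarith) hβ,
          C.pushColor_of_mem_tip c _ hG ⟨hpd, by linarith⟩]
        ring
      · have := mul_pos ht.1 h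
        rw [C.pushColor_of_mem_detour c _ hG hpd (by linarith) hβ,
          C.pushColor_of_mem_tip c _ hA ⟨hmd, by linarith⟩]
        ring
    · have hou' := (C.isOver_push_iff hu hud).1 hou
      have hnear := (C.eventually_mem_pushed_iff hu hud).mono fun _ h => h.2
      have hray := eventually_ray (v := v) hnear
      obtain ⟨t, ht, hm, hp⟩ := hev hray
      rw [C.pushColor_of_notMem c _ hoβ hou'.2.2 (C.onArc_of_notMem hoβ hou'.2.2),
        C.pushColor_of_notMem c _ (hαγ t ht).1 hm (C.onArc_of_notMem (hαγ t ht).1 hm),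
        C.pushColor_of_notMem c _ (hαγ t ht).2 hp (C.onArc_of_notMem (hαγ t ht).2 hp)]
      refine c.rule _ _ _ ⟨o, u, v, hou'.1, (C.isStraightAt_pushed hu hud).1 hv,
        C.onArc_of_notMem hoβ hou'.2.2, ?_⟩
      -- For an old crossing, both rays are shortened until they avoid the detour, where `collapse`
      -- is the identity.
      have h' : ∀ᶠ t in 𝓝[>] (0 : ℝ), t ∈ Ioo 0 ε := Ioo_mem_nhdsGT hε
      obtain ⟨ε', hε', hsub⟩ := mem_nhdsGT_iff_exists_Ioo_subset.1 (h'.and hray)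
      refine ⟨ε', hε', fun s hs => ?_⟩
      obtain ⟨hs, hm, hp⟩ := hsub hs
      exact ⟨C.onArc_of_notMem (hαγ s hs).1 hm, C.onArc_of_notMem (hαγ s hs).2 hp⟩

/-- The detour from its beginning to its turning point. -/
def path (s : ℝ) : E3 := C.pt (1 - 2 * s) (3 * s) (1 - 3 * s)

theorem continuous_path : Continuous C.path := C.continuous_pt.comp
  (by fun_prop : Continuous fun s : ℝ => (1 - 2 * s, 3 * s, 1 - 3 * s))

theorem path_mem_detour {s : ℝ} (h0 : 0 ≤ s) (h1 : s ≤ 1) : C.path s ∈ C.detour := by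
  simp only [path, detour, mem_ofPred_eq, x_pt, y_pt, z_pt]
  exact ⟨by linarith, by linarith, trivial, Or.inl (by ring)⟩

theorem path_mem_cut {s : ℝ} (h0 : 0 ≤ s) (h1 : s ≤ 1) (h : s ≠ 1 / 2) :
    C.path s ∈ (D.push C).cut :=
  C.mem_cut_push_of_detour (C.path_mem_detour h0 h1) fun hx => h (by
    simp only [path, x_pt] at hx; linarith)

theorem path_add (t : ℝ) : C.path (1 / 2) + t • C.L.symm (-2, 3, -3) = C.path (1 / 2 + t) := by
  obtain ⟨hx, hy, hz⟩ := C.coords_add_smul (C.path (1 / 2)) (C.L.symm (-2, 3, -3)) t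
  apply C.ext_coords
  · rw [hx]; simp only [path, x_pt, C.L.apply_symm_apply]; ring
  · rw [hy]; simp only [path, y_pt, C.L.apply_symm_apply]; ring
  · rw [hz]; simp only [path, z_pt, C.L.apply_symm_apply]; ring

theorem path_half : C.path (1 / 2) = C.pt 0 (3 / 2) (-1 / 2) := by
  apply C.ext_coords <;> simp only [path, x_pt, y_pt, z_pt] <;> norm_num

/-- The first crossing of the detour. -/
theorem isCrossing_push {α β γ : (D.push C).Arc} (hα : (D.push C).OnArc (C.path 0) α)
    (hβ : (D.push C).OnArc (C.pt 0 (3 / 2) 0) β) (hγ : (D.push C).OnArc (C.path 1) γ) :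
    (D.push C).IsCrossing α β γ := by
  have hd : C.path (1 / 2) ∈ C.detour := C.path_mem_detour (by norm_num) (by norm_num)
  refine ⟨C.pt 0 (3 / 2) 0, C.path (1 / 2), C.L.symm (-2, 3, -3), ?_, ?_, hβ, 1 / 2, by norm_num,
    fun t ht => ?_⟩
  · have := C.isOver_push_of_detour hd (by simp [path])
    rw [C.path_half] at this ⊢
    simpa only [y_pt] using this
  · rw [C.path_half]
    exact C.isStraightAt_left
  · rw [sub_eq_add_neg, ← neg_smul, C.path_add, C.path_add]
    constructor
    · refine hα.of_isPreconnected (S := C.path '' Ico 0 (1 / 2))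
        (isPreconnected_Ico.image _ C.continuous_path.continuousOn) ?_ ⟨0, by norm_num, rfl⟩
        ⟨_, ⟨by linarith [ht.2], by linarith [ht.1]⟩, rfl⟩
      rintro _ ⟨s, hs, rfl⟩
      exact C.path_mem_cut hs.1 (by linarith [hs.2]) hs.2.ne
    · refine hγ.of_isPreconnected (S := C.path '' Ioc (1 / 2) 1)
        (isPreconnected_Ioc.image _ C.continuous_path.continuousOn) ?_ ⟨1, by norm_num, rfl⟩
        ⟨_, ⟨by linarith [ht.1], by linarith [ht.2]⟩, rfl⟩
      rintro _ ⟨s, hs, rfl⟩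
      exact C.path_mem_cut (by linarith [hs.1]) hs.2 hs.1.ne'

end CrossingChart

/-! ### Producing all colors -/

/-- Pushing the upper strand of a crossing below the lower one creates a crossing whose lower and
upper arcs have the colors of the upper and of a lower arc of the given one. -/
theorem Coloring.exists_push {p : ℕ} {D : Diagram} {L : Link} (hD : D.IsDiagramOf L)
    (c : Coloring p D) {α β γ : D.Arc} (h : D.IsCrossing α β γ) :
    ∃ (D' : Diagram) (c' : Coloring p D') (α' β' γ' : D'.Arc), D'.IsDiagramOf L ∧
      D'.IsCrossing α' β' γ' ∧ c'.color α' = c.color β ∧ c'.color β' = c.color γ ∧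
      range c.color ⊆ range c'.color := by
  obtain ⟨o, u, v, hou, hv, hoβ, ε, hε, hαγ⟩ := h
  obtain ⟨C, hCo, t, ht0, ht, hCu⟩ := D.exists_crossingChart hou hv hε
  have hβ : D.OnArc (C.pt 0 0 1) β := by
    rw [CrossingChart.pt, hCo]; exact hoβ
  have hγ : D.OnArc (C.pt 0 1 0) γ := by
    rw [CrossingChart.pt, hCu]; exact (hαγ t ⟨ht0, ht⟩).2
  obtain ⟨hm, hmd⟩ := C.under_mem_pushed (t := 3 / 2) (by norm_num) (by norm_num)
  have hγ' := C.under_onArc (t := 3 / 2) (by norm_num) (by norm_num) hγ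
  have h0 := C.path_mem_cut le_rfl zero_le_one (by norm_num)
  have h1 := C.path_mem_cut zero_le_one le_rfl (by norm_num)
  have hα' : (C.pushColoring c hβ hγ).color (ConnectedComponents.mk ⟨_, h0⟩) = c.color β :=
    C.pushColor_of_mem_detour c _ (Diagram.onArc_mk h0) (C.path_mem_detour le_rfl zero_le_one)
      (by simp [CrossingChart.path]) hβ
  refine ⟨D.push C, C.pushColoring c hβ hγ, _, _, _, hD.push C, C.isCrossing_push
    (Diagram.onArc_mk h0)
    (Diagram.onArc_mk ((C.mem_cut_push_iff hm hmd).2 hγ'.1)) (Diagram.onArc_mk h1), hα',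
    C.pushColor_of_notMem c _ (Diagram.onArc_mk _) hmd hγ', ?_⟩
  rintro _ ⟨δ, rfl⟩
  obtain ⟨⟨q, hq⟩, rfl⟩ := ConnectedComponents.surjective_coe δ
  -- No color is lost: points off the piece stay in the link with their color, and the color
  -- `c.color β` of the piece remains at the start of the detour.
  by_cases hqp : q ∈ C.piece
  · have hq' := C.eq_pt rfl hqp.2.2.1 hqp.2.2.2
    have hqβ : D.OnArc q β := by
      rw [hq']
      exact C.over_onArc (by simp) (abs_le.2 ⟨by linarith [hqp.1], by linarith [hqp.2.1]⟩) hβ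
    rw [(Diagram.onArc_mk hq).unique hqβ]
    exact ⟨_, hα'⟩
  · have hqd : q ∉ C.detour := by
      intro hqd
      rcases C.eq_of_mem_detour_of_mem hqd hq.1 with rfl | rfl
      · exact hqp C.pt_one_mem_piece
      · exact hqp C.pt_two_mem_piece
    exact ⟨_, C.pushColor_of_notMem c _
      (Diagram.onArc_mk ((C.mem_cut_push_iff (Or.inl ⟨hq.1, hqp⟩) hqd).2 hq)) hqd
      (Diagram.onArc_mk hq)⟩

/-- Repeated pushing produces all the colors of an arithmetic progression. -/
theorem Coloring.exists_progression {p : ℕ} {D : Diagram} {L : Link} (hD : D.IsDiagramOf L)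
    (c : Coloring p D) {α β γ : D.Arc} (h : D.IsCrossing α β γ) {a d : ZMod p}
    (hα : c.color α = a) (hβ : c.color β = a + d) (n : ℕ) :
    ∃ (D' : Diagram) (c' : Coloring p D') (α' β' γ' : D'.Arc), D'.IsDiagramOf L ∧
      D'.IsCrossing α' β' γ' ∧ c'.color α' = a + n * d ∧ c'.color β' = a + (n + 1) * d ∧
      ∀ k ≤ n, a + k * d ∈ range c'.color := by
  induction n with
  | zero =>
    refine ⟨D, c, α, β, γ, hD, h, by simp [hα], by simp [hβ], fun k hk => ⟨α, ?_⟩⟩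
    simp [hα, Nat.le_zero.1 hk]
  | succ n ih =>
    obtain ⟨D', c', α', β', γ', hD', h', hα', hβ', hr⟩ := ih
    obtain ⟨D'', c'', α'', β'', γ'', hD'', h'', hα'', hβ'', hr'⟩ := c'.exists_push hD' h'
    -- The third color is not carried through the induction, as the rule at the crossing determines
    -- it.
    have hγ' : c'.color γ' = a + (n + 1 + 1) * d := by
      have := c'.rule _ _ _ h'
      rw [hα', hβ'] at this
      linear_combination -this
    refine ⟨D'', c'', α'', β'', γ'', hD'', h'', by rw [hα'', hβ']; push_cast; rfl,
      by rw [hβ'', hγ']; push_cast; rfl, fun k hk => ?_⟩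
    rcases Nat.le_succ_iff.1 hk with hk | rfl
    · exact hr' (hr k hk)
    · exact ⟨α'', by rw [hα'', hβ']; push_cast; rfl⟩

theorem Coloring.numColors_le {p : ℕ} [NeZero p] {D : Diagram} (c : Coloring p D) :
    c.numColors ≤ p := by
  have := Set.ncard_le_card (Set.range c.color)
  rwa [Nat.card_zmod] at this

theorem maxColorsOn_le (p : ℕ) [NeZero p] (D : Diagram) : maxColorsOn p D ≤ p := by
  -- In `ℕ` the supremum of the empty set is `0`, so a diagram without non-trivial colorings needs
  -- no separate case.
  refine csSup_le' ?_
  rintro _ ⟨c, -, rfl⟩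
  exact c.numColors_le

theorem maxcol_eq_of_surjective {p : ℕ} (hp : 1 < p) {D : Diagram} {L : Link} (hD : D.IsDiagramOf L)
    (c : Coloring p D) (hc : range c.color = univ) : maxcol p L = p := by
  have : NeZero p := ⟨by omega⟩
  have : Fact (1 < p) := ⟨hp⟩
  have hnum : c.numColors = p := by
    rw [Coloring.numColors, hc, Set.ncard_univ, Nat.card_zmod]
  have hnt : c.IsNontrivial := by
    obtain ⟨α, hα⟩ : (0 : ZMod p) ∈ range c.color := hc ▸ mem_univ _
    obtain ⟨β, hβ⟩ : (1 : ZMod p) ∈ range c.color := hc ▸ mem_univ _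
    exact ⟨α, β, by rw [hα, hβ]; exact zero_ne_one⟩
  apply le_antisymm
  · refine csSup_le' ?_
    rintro _ ⟨D', -, rfl⟩
    exact maxColorsOn_le p D'
  · have h1 : p ≤ maxColorsOn p D := by
      refine le_csSup ⟨p, ?_⟩ ⟨c, hnt, hnum⟩
      rintro _ ⟨c', -, rfl⟩
      exact c'.numColors_le
    refine h1.trans (le_csSup ⟨p, ?_⟩ ⟨D, hD, rfl⟩)
    rintro _ ⟨D', -, rfl⟩
    exact maxColorsOn_le p D'

/-- A crossing whose colors differ by a unit yields a diagram that uses all colors. -/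
theorem maxcol_eq_of_isCrossing {p : ℕ} (hp : 1 < p) {D : Diagram} {L : Link}
    (hD : D.IsDiagramOf L) (c : Coloring p D) {α β γ : D.Arc} (h : D.IsCrossing α β γ)
    (hu : IsUnit (c.color β - c.color α)) : maxcol p L = p := by
  have : NeZero p := ⟨by omega⟩
  obtain ⟨D', c', -, -, -, hD', -, -, -, hr⟩ := c.exists_progression hD h rfl
    (d := c.color β - c.color α) (by ring) p
  refine maxcol_eq_of_surjective hp hD' c' (eq_univ_of_forall fun x => ?_)
  obtain ⟨e, he⟩ := hu.exists_left_inv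
  -- The color `x` is `a + kd` with `k = (x - a) / d`, whose representative is below `p`; so `p`
  -- pushes suffice.
  have := hr ((x - c.color α) * e).val (ZMod.val_lt _).le
  rwa [ZMod.natCast_zmod_val, mul_assoc, he, mul_one, add_sub_cancel] at this

end FoxColoring

theorem corollary2 (p : ℕ) (hp : 1 < p) (L : FoxColoring.Link) (hL : ¬ L.IsSplit)
    (hcol : FoxColoring.AdmitsNontrivialColoring p L) :
    ((∃ D : FoxColoring.Diagram, D.IsDiagramOf L ∧
        ∃ c : FoxColoring.Coloring p D, c.IsNontrivial ∧ c.numColors = FoxColoring.mincol p L ∧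
          ∃ α β γ : D.Arc, D.IsCrossing α β γ ∧
            c.color α = 0 ∧ c.color β = 1 ∧ c.color γ = 2) →
      FoxColoring.maxcol p L = p) ∧
    ((∃ D : FoxColoring.Diagram, D.IsDiagramOf L ∧
        ∃ c : FoxColoring.Coloring p D, c.IsNontrivial ∧ c.numColors = FoxColoring.mincol p L ∧
          ∃ α β γ : D.Arc, D.IsCrossing α β γ ∧
            ∃ a b : ZMod p, c.color α = a ∧ c.color β = b ∧ c.color γ = 2 * b - a ∧
              IsUnit (b - a)) →
      FoxColoring.maxcol p L = p) := by
  constructor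
  · rintro ⟨D, hD, c, -, -, α, β, γ, h, hα, hβ, -⟩
    -- Here the difference is `1 - 0 = 1`, a unit for every modulus.
    exact FoxColoring.maxcol_eq_of_isCrossing hp hD c h (by simp [hα, hβ])
  · rintro ⟨D, hD, c, -, -, α, β, γ, h, a, b, rfl, rfl, -, hu⟩
    exact FoxColoring.maxcol_eq_of_isCrossing hp hD c h hu
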